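/- **Setting.** Fix integers $m,n\ge 1$ and a real number $p>n$. Let $\mathcal M$ be the set of multi-indices $\alpha\in\mathbb Z_{\ge0}^n$ with $|\alpha|\le m-1$, and $\mathcal P$ the space of real polynomials on $\mathbb R^n$ of degree at most $m-1$. For distinct multi-indices write $\alpha<\beta$ if $\sum_{i\le k}\alpha_i<\sum_{i\le k}\beta_i$ for the largest $k\in\{0,\dots,n\}$ at which these two partial sums differ. For distinct $\mathcal A',\mathcal A\subset\mathcal M$ write $\mathcal A'<\mathcal A$ if the minimal element of $\mathcal A'\,\Delta\,\mathcal A$ lies in $\mathcal A'$. Let $L^{m,p}(\mathbb R^n)$ be the homogeneous Sobolev space with seminorm $\|F\|=\max_{|\alpha|=m}\|\partial^\alpha F\|_{L^p(\mathbb R^n)}$ (distributional derivatives), its elements being taken as $C^{m-1}$ functions, and let $J_xF\in\mathcal P$ be the Taylor polynomial of $F$ at $x$ of degree $m-1$. For $x\in\mathbb R^n$ and $E\subset\mathbb R^n$ put $$\sigma(x,E)=\{J_x\varphi:\ \varphi\in L^{m,p}(\mathbb R^n),\ \varphi|_E=0,\ \|\varphi\|\le1\}.$$ For $\epsilon,\delta>0$,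 an $(\mathcal A,x,\epsilon,\delta)$-basis for $\sigma\subset\mathcal P$ is a family $(P_\alpha)_{\alpha\in\mathcal A}$ in $\mathcal P$ such that $P_\alpha\in\epsilon\,\delta^{n/p+|\alpha|-m}\sigma$ for $\alpha\in\mathcal A$; $\partial^\beta P_\alpha(x)=\delta_{\alpha\beta}$ for $\alpha,\beta\in\mathcal A$; and $|\partial^\beta P_\alpha(x)|\le\epsilon\,\delta^{|\alpha|-|\beta|}$ for $\alpha\in\mathcal A$, $\beta\in\mathcal M$, $\beta>\alpha$. A dyadic cube is a set $Q=\prod_{i=1}^n(j_i2^k,(j_i+1)2^k]$ with $j_i,k\in\mathbb Z$; its sidelength is $\delta_Q=2^k$, and for $A>0$, $AQ$ is the (half-open) cube with the same center and sidelength $A\delta_Q$. Let $Q^\circ=(0,1]^n$. Let $\mathcal A\subsetneq\mathcal M$, $\epsilon_0>0$, and let $E\subset\frac18Q^\circ$ be a finite set with $N=\#(E)\ge2$, such that for every $\mathcal A'<\mathcal A$ there is $x\in E$ for which $\sigma(x,E)$ does not contain an $(\mathcal A',x,\epsilon_0,1)$-basis. A dyadic cube $Q\subset Q^\circ$ is OK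 if either $\#(E\cap3Q)\le1$, or there is $\mathcal A'<\mathcal A$ such that $\sigma(x,E\cap3Q)$ contains an $(\mathcal A',x,\epsilon_0,30\delta_Q)$-basis for every $x\in E\cap3Q$. Let $CZ^\circ$ be the collection of the OK dyadic cubes $Q\subset Q^\circ$ such that no dyadic cube $Q'$ with $Q\subsetneq Q'\subset Q^\circ$ is OK. For $Q,Q'\in CZ^\circ$ write $Q\leftrightarrow Q'$ if $\mathrm{cl}(Q)\cap\mathrm{cl}(Q')\ne\emptyset$. A cube $Q\in CZ^\circ$ is a keystone cube if $\delta_{Q'}\ge\delta_Q$ for every $Q'\in CZ^\circ$ that meets $100Q$. **Proposition.** There are constants $C>0$ and $c\in(0,1)$, depending only on $m,n,p$, such that for all $\mathcal A,\epsilon_0,E$ as above the collection $CZ^\circ=\{Q_1,\dots,Q_{\nu_{\max}}\}$ is finite, and to each $Q_\nu\in CZ^\circ$ one can assign a finite sequence $\mathcal S_\nu=(Q_{\nu,1},\dots,Q_{\nu,L_\nu})$ (with $L_\nu\ge1$) of cubes from $CZ^\circ$ such that: * **(K1)** $Q_{\nu,1}=Q_\nu$ and $Q_{\nu,L_\nu}$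 is a keystone cube; $Q_{\nu,l}\leftrightarrow Q_{\nu,l+1}$ for $1\le l\le L_\nu-1$; and $\delta_{Q_{\nu,k}}\le C(1-c)^{k-l}\delta_{Q_{\nu,l}}$ for $1\le l\le k\le L_\nu$. * **(K2)** With $\mathcal K(Q_\nu)=Q_{\nu,L_\nu}$, $$\#\{(\nu,\nu')\in\{1,\dots,\nu_{\max}\}^2:\ Q_\nu\leftrightarrow Q_{\nu'}\ \text{and}\ \mathcal K(Q_\nu)\ne\mathcal K(Q_{\nu'})\}\le C\,N.$$ * **(K3)** $\mathcal K(Q_\nu)=Q_\nu$ for every keystone cube $Q_\nu$. -/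

import Mathlib

open MeasureTheory
open scoped Pointwise ContDiff

noncomputable section

namespace SobolevExt

/-! ### Multi-indices and labels -/

/-- The order `|α| = α₁ + ⋯ + αₙ` of a multi-index. -/
def miOrder {n : ℕ} (α : Fin n → ℕ) : ℕ := ∑ i, α i

/-- The set `𝓜` of the multi-indices of order at most `m - 1` (for `m ≥ 1`). -/
def multiIndices (n m : ℕ) : Finset (Fin n → ℕ) :=
  (Fintype.piFinset fun _ => Finset.range m).filter fun α => miOrder α < m

/-- The partial sum `α₁ + ⋯ + αₖ`. -/
def partialSum {n : ℕ} (α : Fin n → ℕ) (k : ℕ) : ℕ :=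
  ∑ i ∈ Finset.univ.filter (fun i : Fin n => i.val < k), α i

/-- The order on multi-indices: `α < β` if, for the largest `k ∈ {0, …, n}` at which the `k`-th
partial sums of `α` and `β` differ, that of `α` is the smaller one. -/
def MultiIndexLT {n : ℕ} (α β : Fin n → ℕ) : Prop :=
  ∃ k ≤ n, (∀ j, k < j → j ≤ n → partialSum α j = partialSum β j) ∧
    partialSum α k < partialSum β k

/-- The order on labels (sets of multi-indices): `𝒜 < ℬ` if the minimal element of the symmetric
difference of `𝒜` and `ℬ` lies in `𝒜`. -/
def LabelLT {n : ℕ} (𝒜 ℬ : Finset (Fin n → ℕ)) : Prop :=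
  ∃ α ∈ symmDiff 𝒜 ℬ, α ∈ 𝒜 ∧ ∀ β ∈ symmDiff 𝒜 ℬ, β ≠ α → MultiIndexLT α β

/-! ### Derivatives, jets, and the homogeneous Sobolev space

Functions are defined on `Fin n → ℝ`, which carries the maximum norm and Lebesgue measure. -/

/-- The partial derivative `∂ᵢ f`. -/
def pd {n : ℕ} (i : Fin n) (f : (Fin n → ℝ) → ℝ) : (Fin n → ℝ) → ℝ :=
  fun x => fderiv ℝ f x (Pi.single i 1)

/-- The iterated partial derivative `∂₁^{α₁} ⋯ ∂ₙ^{αₙ} f`; it is used for functions that are at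
least `|α|` times continuously differentiable. -/
def pderivs {n : ℕ} (α : Fin n → ℕ) (f : (Fin n → ℝ) → ℝ) : (Fin n → ℝ) → ℝ :=
  (List.finRange n).foldr (fun i g => (pd i)^[α i] g) f

/-- The jet `J_y F`: the Taylor polynomial of `F` at `y` of degree `m - 1`. -/
def jet {n : ℕ} (m : ℕ) (F : (Fin n → ℝ) → ℝ) (y : Fin n → ℝ) : MvPolynomial (Fin n) ℝ :=
  ∑ α ∈ multiIndices n m,
    MvPolynomial.C (pderivs α F y / ((∏ i, (α i).factorial : ℕ) : ℝ)) *
      ∏ i, (MvPolynomial.X i - MvPolynomial.C (y i)) ^ α i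

/-- `g` is the distributional derivative `∂^α F` on `ℝⁿ`. -/
def HasWeakDeriv {n : ℕ} (α : Fin n → ℕ) (F g : (Fin n → ℝ) → ℝ) : Prop :=
  LocallyIntegrable F volume ∧ LocallyIntegrable g volume ∧
    ∀ θ : (Fin n → ℝ) → ℝ, ContDiff ℝ ∞ θ → HasCompactSupport θ →
      ∫ x, F x * pderivs α θ x = (-1) ^ miOrder α * ∫ x, g x * θ x

/-- The seminorm `‖F‖_{L^{m,p}(ℝⁿ)}`, the maximum over `|α| = m` of the `L^p` norm of the weak
derivative `∂^α F`. The weak derivative is unique up to null sets, so that the infimum is over a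
single value; it is `∞` if there is no weak derivative. -/
def sobolevSeminorm {n : ℕ} (m : ℕ) (p : ℝ) (F : (Fin n → ℝ) → ℝ) : ENNReal :=
  ⨆ (α : Fin n → ℕ) (_ : miOrder α = m),
    ⨅ (g : (Fin n → ℝ) → ℝ) (_ : HasWeakDeriv α F g), eLpNorm g (ENNReal.ofReal p) volume

/-- Membership in `L^{m,p}(ℝⁿ)` for `p > n`, each class being represented by its unique member
in `C^{m-1}`. -/
def MemSobolev {n : ℕ} (m : ℕ) (p : ℝ) (F : (Fin n → ℝ) → ℝ) : Prop :=
  ContDiff ℝ ((m - 1 : ℕ) : WithTop ℕ∞) F ∧ sobolevSeminorm m p F < ⊤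

/-- `σ(x, E)`: the jets at `x` of the functions in `L^{m,p}(ℝⁿ)` of seminorm at most one that
vanish on `E`. -/
def sigma {n : ℕ} (m : ℕ) (p : ℝ) (x : Fin n → ℝ) (E : Set (Fin n → ℝ)) :
    Set (MvPolynomial (Fin n) ℝ) :=
  {P | ∃ φ : (Fin n → ℝ) → ℝ, MemSobolev m p φ ∧ jet m φ x = P ∧ (∀ y ∈ E, φ y = 0) ∧
    sobolevSeminorm m p φ ≤ 1}

/-- The number `∂^β P(x)`. -/
def polyDeriv {n : ℕ} (β : Fin n → ℕ) (P : MvPolynomial (Fin n) ℝ) (x : Fin n → ℝ) : ℝ :=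
  pderivs β (fun y => MvPolynomial.eval y P) x

/-- `(P_α)_{α ∈ 𝒜}` forms an `(𝒜, x, ε, δ)`-basis for the set `σ` of polynomials. -/
def IsLabeledBasis {n : ℕ} (m : ℕ) (p : ℝ) (𝒜 : Finset (Fin n → ℕ)) (x : Fin n → ℝ) (ε δ : ℝ)
    (σ : Set (MvPolynomial (Fin n) ℝ)) (P : (Fin n → ℕ) → MvPolynomial (Fin n) ℝ) : Prop :=
  (∀ α ∈ 𝒜, P α ∈ (ε * δ ^ ((n : ℝ) / p + (miOrder α : ℝ) - (m : ℝ))) • σ) ∧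
  (∀ α ∈ 𝒜, ∀ β ∈ 𝒜, polyDeriv β (P α) x = if α = β then 1 else 0) ∧
  (∀ α ∈ 𝒜, ∀ β ∈ multiIndices n m, MultiIndexLT α β →
    |polyDeriv β (P α) x| ≤ ε * δ ^ ((miOrder α : ℝ) - (miOrder β : ℝ)))

/-- The set `σ` of polynomials contains an `(𝒜, x, ε, δ)`-basis. -/
def ContainsBasis {n : ℕ} (m : ℕ) (p : ℝ) (𝒜 : Finset (Fin n → ℕ)) (x : Fin n → ℝ) (ε δ : ℝ)
    (σ : Set (MvPolynomial (Fin n) ℝ)) : Prop :=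
  ∃ P : (Fin n → ℕ) → MvPolynomial (Fin n) ℝ, IsLabeledBasis m p 𝒜 x ε δ σ P

/-! ### Dyadic cubes -/

/-- The dyadic cube `∏ᵢ (jᵢ 2ᵏ, (jᵢ + 1) 2ᵏ]`, given by `k` and `j`
(which it determines when `n ≥ 1`). -/
@[ext] structure DyadicCube (n : ℕ) where
  /-- The exponent of the sidelength. -/
  k : ℤ
  /-- The position. -/
  j : Fin n → ℤ

namespace DyadicCube

variable {n : ℕ}

/-- The sidelength `δ_Q`. -/
def side (Q : DyadicCube n) : ℝ := (2 : ℝ) ^ Q.k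

/-- The cube as a set of points. -/
def toSet (Q : DyadicCube n) : Set (Fin n → ℝ) :=
  {x | ∀ i, (Q.j i : ℝ) * 2 ^ Q.k < x i ∧ x i ≤ ((Q.j i : ℝ) + 1) * 2 ^ Q.k}

/-- The center. -/
def center (Q : DyadicCube n) : Fin n → ℝ := fun i => ((Q.j i : ℝ) + 1 / 2) * 2 ^ Q.k

/-- The cube `A Q` with the same center as `Q` and sidelength `A δ_Q`, as a set of points. -/
def dilate (A : ℝ) (Q : DyadicCube n) : Set (Fin n → ℝ) :=
  {x | ∀ i, Q.center i - A * Q.side / 2 < x i ∧ x i ≤ Q.center i + A * Q.side / 2}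

/-- The unit cube `Q° = (0, 1]ⁿ`. -/
def unit (n : ℕ) : DyadicCube n := ⟨0, fun _ => 0⟩

/-- `Q` and `Q'` are neighbors, `Q ↔ Q'`: their closures meet. -/
def Neighbor (Q Q' : DyadicCube n) : Prop := (closure Q.toSet ∩ closure Q'.toSet).Nonempty

end DyadicCube

/-! ### The Calderón–Zygmund decomposition of the unit cube -/

/-- The dyadic cube `Q` is OK (relative to the label `𝒜`, the number `ε₀` and the set `E`). -/
def IsOK {n : ℕ} (m : ℕ) (p : ℝ) (𝒜 : Finset (Fin n → ℕ)) (ε₀ : ℝ) (E : Finset (Fin n → ℝ))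
    (Q : DyadicCube n) : Prop :=
  ((E : Set (Fin n → ℝ)) ∩ Q.dilate 3).ncard ≤ 1 ∨
  ∃ 𝒜' : Finset (Fin n → ℕ), 𝒜' ⊆ multiIndices n m ∧ LabelLT 𝒜' 𝒜 ∧
    ∀ x ∈ (E : Set (Fin n → ℝ)) ∩ Q.dilate 3,
      ContainsBasis m p 𝒜' x ε₀ (30 * Q.side) (sigma m p x ((E : Set (Fin n → ℝ)) ∩ Q.dilate 3))

/-- The collection `CZ°` of Calderón–Zygmund cubes: the maximal OK dyadic subcubes of `Q°`. -/
def CZ {n : ℕ} (m : ℕ) (p : ℝ) (𝒜 : Finset (Fin n → ℕ)) (ε₀ : ℝ) (E : Finset (Fin n → ℝ)) :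
    Set (DyadicCube n) :=
  {Q | Q.toSet ⊆ (DyadicCube.unit n).toSet ∧ IsOK m p 𝒜 ε₀ E Q ∧
    ∀ Q' : DyadicCube n, Q'.toSet ⊆ (DyadicCube.unit n).toSet → Q.toSet ⊂ Q'.toSet →
      ¬ IsOK m p 𝒜 ε₀ E Q'}

/-- The keystone cubes of a collection `𝒞` of dyadic cubes: those `Q ∈ 𝒞` such that every
`Q' ∈ 𝒞` that meets `100 Q` is at least as large as `Q`. -/
def keystone {n : ℕ} (𝒞 : Set (DyadicCube n)) : Set (DyadicCube n) :=
  {Q | Q ∈ 𝒞 ∧ ∀ Q' ∈ 𝒞, (Q'.toSet ∩ Q.dilate 100).Nonempty → Q.side ≤ Q'.side}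

end SobolevExt

end

open SobolevExt

/-! The statement is one of dyadic geometry. The Sobolev space enters only through a monotonicity:
if `Q` is no larger than an OK cube `Q'` and `3Q ⊆ 3Q'`, then `Q` is OK (`IsOK.mono`). As the parent
of a CZ cube is never OK, this gives the properties collected in `IsWhitney`: the side of a CZ cube
is controlled by the side of any other one plus the distance to it, and every CZ cube has a point of
`E` within a few sidelengths (`isWhitney_CZ`). The rest uses nothing else about `CZ°`.

A cube `Q` that is not keystone has a smaller cube meeting `100Q`. Walking towards it inside a
convex set, one passes only boundedly many cubes of size comparable to `Q` before the sidelength has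
halved. Iteration ends at a keystone cube, along a chain with geometric decay (`exists_keystone`,
`decayPath_of_halfSteps`). This settles (K1) and (K3), but the choices are arbitrary and neighbors
need not agree.

For (K2), call `Q` interstitial if the part of `E` near `Q` is a cluster tiny compared with `Q`,
lying in CZ cubes much smaller than `Q`. Otherwise either a nearby point of `E` lies in a CZ cube
comparable to `Q`, or `Q` sees two points of `E` at a distance comparable to its side. Cubes of the
first kind are charged to that point, those of the second kind to a point whose weight in a
farthest-point enumeration of `E` is comparable to the side (`exists_net_weight`). Each point is
charged boundedly often, so there are `O(N)` such cubes, and `O(N)` pairs of neighbors involving one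
of them.

From an interstitial cube one descends radially towards a pole `x` in the cluster, through cubes
comparable to their distance from `x`, as far as a sphere just outside the cluster; then one moves
within the sphere to a fixed target cube and continues from there to its keystone cube. Neighboring
interstitial cubes see the same points of `E`, hence share pole and radius, and their radial
projections meet; so they get the same target (`exists_target`) and the same keystone cube. Targets
are fixed per component of the sphere, since in dimension one the sphere consists of two points. -/

namespace SobolevExt

variable {n : ℕ}

/-! ### Metric geometry and counting of dyadic cubes -/

namespace DyadicCube

lemma side_pos (Q : DyadicCube n) : 0 < Q.side := by
  unfold side; positivity

lemma mem_toSet_iff {Q : DyadicCube n} {x : Fin n → ℝ} :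
    x ∈ Q.toSet ↔ ∀ i, Q.center i - Q.side / 2 < x i ∧ x i ≤ Q.center i + Q.side / 2 := by
  refine forall_congr' fun i => ?_
  simp only [center, side]
  constructor <;> rintro ⟨h1, h2⟩ <;> constructor <;> linarith

lemma norm_sub_center_le_of_mem {Q : DyadicCube n} {x : Fin n → ℝ} (hx : x ∈ Q.toSet) :
    ‖x - Q.center‖ ≤ Q.side / 2 := by
  rw [pi_norm_le_iff_of_nonneg (by linarith [Q.side_pos])]
  intro i
  rw [mem_toSet_iff] at hx
  rw [Real.norm_eq_abs, abs_le, Pi.sub_apply]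
  constructor <;> linarith [(hx i).1, (hx i).2]

lemma norm_sub_center_le {Q : DyadicCube n} {x : Fin n → ℝ} (hx : x ∈ closure Q.toSet) :
    ‖x - Q.center‖ ≤ Q.side / 2 := by
  have : closure Q.toSet ⊆ Metric.closedBall Q.center (Q.side / 2) :=
    closure_minimal (fun y hy => by
      rw [mem_closedBall_iff_norm]; exact norm_sub_center_le_of_mem hy) Metric.isClosed_closedBall
  exact mem_closedBall_iff_norm.1 (this hx)

lemma center_mem (Q : DyadicCube n) : Q.center ∈ Q.toSet := by
  rw [mem_toSet_iff]; intro i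
  constructor <;> linarith [Q.side_pos]

lemma Neighbor.symm {Q Q' : DyadicCube n} (h : Q.Neighbor Q') : Q'.Neighbor Q := by
  unfold Neighbor at *; rwa [Set.inter_comm]

lemma Neighbor.norm_le {Q Q' : DyadicCube n} (h : Q.Neighbor Q') :
    ‖Q.center - Q'.center‖ ≤ (Q.side + Q'.side) / 2 := by
  obtain ⟨y, h1, h2⟩ := h
  have h1 := norm_sub_center_le h1
  have h2 := norm_sub_center_le h2
  calc ‖Q.center - Q'.center‖ = ‖(y - Q'.center) - (y - Q.center)‖ := by congr 1; abel
    _ ≤ _ := norm_sub_le _ _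
    _ ≤ _ := by linarith

lemma convex_toSet (Q : DyadicCube n) : Convex ℝ Q.toSet := by
  have : Q.toSet = Set.univ.pi fun i =>
      Set.Ioc ((Q.j i : ℝ) * 2 ^ Q.k) (((Q.j i : ℝ) + 1) * 2 ^ Q.k) := by
    ext x; simp [toSet]
  rw [this]
  exact convex_pi fun i _ => convex_Ioc _ _

lemma isPreconnected_closure (Q : DyadicCube n) : IsPreconnected (closure Q.toSet) :=
  Q.convex_toSet.isPreconnected.closure

lemma side_le_half_of_lt {Q Q' : DyadicCube n} (h : Q.side < Q'.side) : Q.side ≤ Q'.side / 2 := by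
  unfold side at *
  have := (zpow_lt_zpow_iff_right₀ (by norm_num : (1 : ℝ) < 2)).1 h
  have h2 : (2 : ℝ) ^ Q'.k / 2 = 2 ^ (Q'.k - 1) := by
    rw [zpow_sub_one₀ (by norm_num)]; rfl
  rw [h2]
  exact zpow_le_zpow_right₀ (by norm_num) (by omega)

/-- Sidelengths are powers of two, so a strict factor four improves to a factor two. -/
lemma side_le_two_mul_of_lt {Q Q' : DyadicCube n} (h : Q'.side < 4 * Q.side) :
    Q'.side ≤ 2 * Q.side := by
  unfold side at *
  have h4 : (4 : ℝ) * 2 ^ Q.k = 2 ^ (Q.k + 2) := by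
    rw [zpow_add₀ (by norm_num)]; norm_num; ring
  have h2 : (2 : ℝ) * 2 ^ Q.k = 2 ^ (Q.k + 1) := by
    rw [zpow_add₀ (by norm_num)]; norm_num; ring
  rw [h4] at h
  have := (zpow_lt_zpow_iff_right₀ (by norm_num : (1 : ℝ) < 2)).1 h
  rw [h2]
  exact zpow_le_zpow_right₀ (by norm_num) (by omega)

/-- Dyadic cubes of sidelengths comparable to `a`, at distance at most a multiple of `a` from a
given point, are boundedly many. -/
lemma exists_packing (n : ℕ) (K : ℝ) : ∃ D : ℕ, ∀ (S : Set (DyadicCube n)) (a : ℝ)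
    (z : Fin n → ℝ), 0 < a →
    (∀ Q ∈ S, a ≤ Q.side ∧ Q.side ≤ K * a ∧ ‖Q.center - z‖ ≤ K * a) →
    S.Finite ∧ S.ncard ≤ D := by
  obtain ⟨M, hM⟩ : ∃ M : ℕ, K ≤ M := exists_nat_ge K
  let T : Finset (ℤ × (Fin n → ℤ)) :=
    Finset.Icc (-(M + 2 : ℤ)) (M + 2) ×ˢ Fintype.piFinset fun _ => Finset.Icc (-(M + 2 : ℤ)) (M + 2)
  refine ⟨T.card, fun S a z ha hS => ?_⟩
  -- A cube is encoded by its scale relative to `a` and its position relative to `z`, measured in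
  -- its own sidelength; both range over a bounded box of integers.
  let F : DyadicCube n → ℤ × (Fin n → ℤ) := fun Q =>
    (Q.k - Int.log 2 a, fun i => Q.j i - ⌊z i / 2 ^ Q.k⌋)
  have hF : Function.Injective F := by
    intro Q Q' h
    simp only [F, Prod.mk.injEq] at h
    have hk : Q.k = Q'.k := by linarith [h.1]
    ext i
    · exact hk
    · have := congrFun h.2 i
      rw [hk] at this
      simpa using this
  have hlog1 : (2 : ℝ) ^ Int.log 2 a ≤ a := by
    simpa using Int.zpow_log_le_self (b := 2) (by norm_num) ha
  have hlog2 : a < (2 : ℝ) ^ (Int.log 2 a + 1) := by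
    simpa using Int.lt_zpow_succ_log_self (b := 2) (by norm_num) a
  have hmaps : ∀ Q ∈ S, F Q ∈ (T : Set (ℤ × (Fin n → ℤ))) := by
    intro Q hQ
    obtain ⟨h1, h2, h3⟩ := hS Q hQ
    have hpos : (0 : ℝ) < 2 ^ Q.k := by positivity
    have hM2 : (M : ℝ) < 2 ^ (M : ℤ) := by
      rw [zpow_natCast]; exact_mod_cast Nat.lt_two_pow_self
    simp only [T, Finset.coe_product, Set.mem_prod, Finset.mem_coe, Finset.mem_Icc,
      Fintype.mem_piFinset, F]
    unfold side at h1 h2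
    refine ⟨⟨?_, ?_⟩, fun i => ?_⟩
    · have : (2 : ℝ) ^ Int.log 2 a ≤ 2 ^ Q.k := hlog1.trans h1
      have := (zpow_le_zpow_iff_right₀ (by norm_num : (1 : ℝ) < 2)).1 this
      omega
    · have : (2 : ℝ) ^ Q.k < 2 ^ ((M : ℤ) + (Int.log 2 a + 1)) := by
        rw [zpow_add₀ (by norm_num)]
        calc (2 : ℝ) ^ Q.k ≤ K * a := h2
          _ ≤ M * a := by gcongr
          _ ≤ 2 ^ (M : ℤ) * a := by gcongr
          _ < _ := by gcongr
      have := (zpow_lt_zpow_iff_right₀ (by norm_num : (1 : ℝ) < 2)).1 this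
      omega
    · have hi : |(Q.center - z) i| ≤ K * a := (norm_le_pi_norm (Q.center - z) i).trans h3
      have hi2 : |(Q.center - z) i| ≤ M * 2 ^ Q.k := by
        refine hi.trans ?_
        calc K * a ≤ M * a := by gcongr
          _ ≤ _ := by gcongr
      have hz : z i = (z i / 2 ^ Q.k) * 2 ^ Q.k := by field_simp
      have f1 := Int.floor_le (z i / 2 ^ Q.k)
      have f2 := Int.lt_floor_add_one (z i / 2 ^ Q.k)
      have hi3 : |(Q.j i : ℝ) + 1 / 2 - z i / 2 ^ Q.k| ≤ M := by
        have : (Q.center - z) i = ((Q.j i : ℝ) + 1 / 2 - z i / 2 ^ Q.k) * 2 ^ Q.k := by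
          rw [Pi.sub_apply, sub_mul, ← hz]; rfl
        rw [this, abs_mul, abs_of_pos hpos] at hi2
        exact le_of_mul_le_mul_right hi2 hpos
      rw [abs_le] at hi3
      constructor
      · have : (-(M + 2 : ℤ) : ℝ) ≤ (Q.j i - ⌊z i / 2 ^ Q.k⌋ : ℝ) := by
          push_cast; linarith
        exact_mod_cast this
      · have : (Q.j i - ⌊z i / 2 ^ Q.k⌋ : ℝ) ≤ ((M + 2 : ℤ) : ℝ) := by
          push_cast; linarith
        exact_mod_cast this
  refine ⟨Set.Finite.of_finite_image ((T.finite_toSet).subset (Set.image_subset_iff.2 hmaps))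
    hF.injOn, ?_⟩
  rw [← Set.ncard_coe_finset T]
  exact Set.ncard_le_ncard_of_injOn F hmaps hF.injOn T.finite_toSet

/-- Counting dyadic cubes that can be charged, with bounded multiplicity, to a finite set. -/
lemma exists_charging (n : ℕ) (K : ℝ) : ∃ D : ℕ, ∀ (S : Set (DyadicCube n))
    (E : Finset (Fin n → ℝ)) (a : (Fin n → ℝ) → ℝ),
    (∀ Q ∈ S, ∃ z ∈ E, 0 < a z ∧ a z ≤ Q.side ∧ Q.side ≤ K * a z ∧ ‖Q.center - z‖ ≤ K * a z) →
    S.Finite ∧ S.ncard ≤ D * E.card := by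
  classical
  obtain ⟨D, hD⟩ := exists_packing n K
  refine ⟨D, fun S E a hS => ?_⟩
  let T : (Fin n → ℝ) → Set (DyadicCube n) := fun z =>
    {Q | 0 < a z ∧ a z ≤ Q.side ∧ Q.side ≤ K * a z ∧ ‖Q.center - z‖ ≤ K * a z}
  have hT : ∀ z, (T z).Finite ∧ (T z).ncard ≤ D := by
    intro z
    by_cases hz : 0 < a z
    · exact hD (T z) (a z) z hz fun Q hQ => hQ.2
    · have : T z = ∅ := by
        ext Q; simp [T, hz]
      rw [this]; simp
  have hsub : S ⊆ ⋃ z ∈ E, T z := by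
    intro Q hQ
    obtain ⟨z, hz, h⟩ := hS Q hQ
    exact Set.mem_biUnion (by exact_mod_cast hz) h
  have hfin : (⋃ z ∈ E, T z).Finite := Set.Finite.biUnion E.finite_toSet fun z _ => (hT z).1
  refine ⟨hfin.subset hsub, (Set.ncard_le_ncard hsub hfin).trans ?_⟩
  calc (⋃ z ∈ E, T z).ncard ≤ ∑ z ∈ E, (T z).ncard := Finset.set_ncard_biUnion_le E T
    _ ≤ ∑ z ∈ E, D := Finset.sum_le_sum fun z _ => (hT z).2
    _ = D * E.card := by rw [Finset.sum_const, smul_eq_mul, mul_comm]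

end DyadicCube

/-! ### Farthest-point enumeration of a finite metric space -/

/-- A finite set is exhausted by nets: there is a weight `r` such that, for every `s < S`, the
points of weight more than `s` form an `s`-dense subset, while two points are never closer than
both of their weights. -/
lemma exists_net_weight {X : Type*} [MetricSpace X] (E : Finset X) (S : ℝ) :
    ∃ r : X → ℝ, (∀ x ∈ E, ∀ y ∈ E, x ≠ y → min (r x) (r y) ≤ dist x y) ∧
      ∀ s, 0 < s → s < S → ∀ x ∈ E, ∃ z ∈ E, s < r z ∧ dist x z ≤ s := by
  classical
  rcases E.eq_empty_or_nonempty with rfl | ⟨x₀, hx₀⟩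
  · exact ⟨fun _ => 0, by simp⟩
  -- `P` consists of the points enumerated so far and `D` is a radius at which `P` covers `E`. The
  -- density claim is made for `s ≥ D` only; below `D` all of `P` has weight more than `s`.
  suffices H : ∀ k < E.card, ∃ (P : Finset X) (r : X → ℝ) (D : ℝ), P ⊆ E ∧ P.card = k + 1 ∧
      (∀ x ∈ P, ∀ y ∈ P, x ≠ y → min (r x) (r y) ≤ dist x y) ∧ (∀ z ∈ P, D ≤ r z) ∧
      (∀ x ∈ E, ∃ z ∈ P, dist x z ≤ D) ∧
      ∀ s, D ≤ s → s < S → ∀ x ∈ E, ∃ z ∈ P, s < r z ∧ dist x z ≤ s by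
    have hc : 0 < E.card := Finset.card_pos.2 ⟨x₀, hx₀⟩
    obtain ⟨P, r, D, hPE, hP, h1, h2, -, h4⟩ := H (E.card - 1) (by omega)
    obtain rfl : P = E := Finset.eq_of_subset_of_card_le hPE (by omega)
    refine ⟨r, h1, fun s hs hsS x hx => ?_⟩
    rcases le_or_gt D s with h | h
    · exact h4 s h hsS x hx
    · exact ⟨x, hx, h.trans_le (h2 x hx), by rw [dist_self]; exact hs.le⟩
  intro k
  induction k with
  | zero =>
    intro _
    -- The sum is a crude covering radius for one point; the maximum with `S` leaves no `s` with `D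
    -- ≤ s < S`.
    refine ⟨{x₀}, fun _ => max S (∑ x ∈ E, dist x x₀), max S (∑ x ∈ E, dist x x₀),
      by simpa using hx₀, by simp, ?_, by simp, ?_, ?_⟩
    · intro x hx y hy hxy
      rw [Finset.mem_singleton] at hx hy
      exact absurd (hx.trans hy.symm) hxy
    · intro x hx
      refine ⟨x₀, by simp, le_max_of_le_right ?_⟩
      exact Finset.single_le_sum (f := fun x => dist x x₀) (fun _ _ => dist_nonneg) hx
    · intro s hs hs'
      exact absurd ((le_max_left _ _).trans hs) (not_le.2 hs')
  | succ k ih =>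
    intro hk
    obtain ⟨P, r, D, hPE, hP, h1, h2, h3, h4⟩ := ih (by omega)
    have hPne : P.Nonempty := Finset.card_pos.1 (by omega)
    have hne : (E \ P).Nonempty := by
      rw [← Finset.card_pos, Finset.card_sdiff_of_subset hPE]; omega
    let g : X → ℝ := fun x => P.inf' hPne (dist x)
    -- The next point is farthest from `P`. Its distance to `P` is both its weight and the new
    -- covering radius, whence separation and density.
    obtain ⟨w, hw, hmax⟩ := Finset.exists_max_image (E \ P) g hne
    rw [Finset.mem_sdiff] at hw
    have hgP : ∀ x ∈ P, g x ≤ 0 := fun x hx => by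
      have := Finset.inf'_le (dist x) hx
      simpa using this
    have hg0 : 0 ≤ g w := by
      rw [Finset.le_inf'_iff]; intro _ _; exact dist_nonneg
    have hcov : ∀ x ∈ E, ∃ z ∈ P, dist x z ≤ g w := by
      intro x hx
      obtain ⟨z, hz, hxz⟩ := Finset.exists_mem_eq_inf' hPne (dist x)
      refine ⟨z, hz, ?_⟩
      rw [← hxz]
      by_cases hxP : x ∈ P
      · exact (hgP x hxP).trans hg0
      · exact hmax x (Finset.mem_sdiff.2 ⟨hx, hxP⟩)
    have hgw : ∀ z ∈ P, g w ≤ dist w z := fun z hz => Finset.inf'_le _ hz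
    have hgD : g w ≤ D := by
      obtain ⟨z, hz, h⟩ := h3 w hw.1
      exact (hgw z hz).trans h
    have hrne : ∀ z ∈ P, Function.update r w (g w) z = r z := fun z hz =>
      Function.update_of_ne (by rintro rfl; exact hw.2 hz) _ _
    refine ⟨insert w P, Function.update r w (g w), g w, Finset.insert_subset hw.1 hPE, ?_,
      ?_, ?_, ?_, ?_⟩
    · rw [Finset.card_insert_of_notMem hw.2, hP]
    · intro x hx y hy hxy
      rw [Finset.mem_insert] at hx hy
      rcases hx with rfl | hx <;> rcases hy with rfl | hy
      · exact absurd rfl hxy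
      · exact (min_le_left _ _).trans (by rw [Function.update_self]; exact hgw y hy)
      · exact (min_le_right _ _).trans (by
          rw [Function.update_self, dist_comm]; exact hgw x hx)
      · rw [hrne x hx, hrne y hy]; exact h1 x hx y hy hxy
    · intro z hz
      rcases Finset.mem_insert.1 hz with rfl | hz
      · rw [Function.update_self]
      · rw [hrne z hz]; exact hgD.trans (h2 z hz)
    · intro x hx
      obtain ⟨z, hz, h⟩ := hcov x hx
      exact ⟨z, Finset.mem_insert_of_mem hz, h⟩
    · intro s hs hsS x hx
      rcases le_or_gt D s with h | h
      · obtain ⟨z, hz, h5, h6⟩ := h4 s h hsS x hx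
        exact ⟨z, Finset.mem_insert_of_mem hz, by rwa [hrne z hz], h6⟩
      · obtain ⟨z, hz, h5⟩ := hcov x hx
        exact ⟨z, Finset.mem_insert_of_mem hz, by
          rw [hrne z hz]; exact h.trans_le (h2 z hz), h5.trans hs⟩

/-! ### Walks in a collection of cubes -/

/-- The cubes of `𝒞` whose closure meets `G`. -/
def meeting (𝒞 : Set (DyadicCube n)) (G : Set (Fin n → ℝ)) : Set (DyadicCube n) :=
  {Q ∈ 𝒞 | (closure Q.toSet ∩ G).Nonempty}

/-- The neighbor graph on a collection of cubes. -/
def nbGraph (W : Set (DyadicCube n)) : SimpleGraph W :=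
  SimpleGraph.fromRel fun a b => a.1.Neighbor b.1

lemma nbGraph_reachable_of_neighbor {W : Set (DyadicCube n)} {a b : W} (h : a.1.Neighbor b.1) :
    (nbGraph W).Reachable a b := by
  by_cases hab : a = b
  · rw [hab]
  · exact SimpleGraph.Adj.reachable ((SimpleGraph.fromRel_adj _ _ _).2 ⟨hab, Or.inl h⟩)

lemma nbGraph_adj {W : Set (DyadicCube n)} {a b : W} (h : (nbGraph W).Adj a b) :
    a.1.Neighbor b.1 := by
  rcases ((SimpleGraph.fromRel_adj _ _ _).1 h).2 with h | h
  · exact h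
  · exact h.symm

lemma nbGraph_reachable_mono {W W' : Set (DyadicCube n)} (h : W ⊆ W') {a b : W}
    (hab : (nbGraph W).Reachable a b) :
    (nbGraph W').Reachable ⟨a.1, h a.2⟩ ⟨b.1, h b.2⟩ := by
  obtain ⟨p⟩ := hab
  induction p with
  | nil => exact SimpleGraph.Reachable.refl _
  | @cons u v _ hadj _ ih =>
    have hn : u.1.Neighbor v.1 := nbGraph_adj hadj
    exact (nbGraph_reachable_of_neighbor (a := ⟨u.1, h u.2⟩) (b := ⟨v.1, h v.2⟩) hn).trans ih

/-- The cubes of a finite cover that meet a connected set are connected through neighbors. -/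
lemma nbGraph_meeting_reachable {𝒞 : Set (DyadicCube n)} (hfin : 𝒞.Finite)
    {G : Set (Fin n → ℝ)} (hG : IsPreconnected G)
    (hcov : ∀ y ∈ G, ∃ Q ∈ 𝒞, y ∈ closure Q.toSet) (a b : meeting 𝒞 G) :
    (nbGraph (meeting 𝒞 G)).Reachable a b := by
  by_contra hab
  let W := meeting 𝒞 G
  let A : Set W := {w | (nbGraph W).Reachable a w}
  have hWfin : Finite W := (hfin.subset fun Q hQ => hQ.1).to_subtype
  let F : Set W → Set (Fin n → ℝ) := fun V => ⋃ w ∈ V, closure w.1.toSet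
  have hF : ∀ V, IsClosed (F V) := fun V =>
    (Set.toFinite V).isClosed_biUnion fun _ _ => isClosed_closure
  have hsub : G ⊆ F A ∪ F Aᶜ := by
    intro y hy
    obtain ⟨Q, hQ, hyQ⟩ := hcov y hy
    let w : W := ⟨Q, hQ, y, hyQ, hy⟩
    by_cases hw : w ∈ A
    · exact Or.inl (Set.mem_biUnion hw hyQ)
    · exact Or.inr (Set.mem_biUnion (show w ∈ Aᶜ from hw) hyQ)
  obtain ⟨ya, hya, hya'⟩ := a.2.2
  obtain ⟨yb, hyb, hyb'⟩ := b.2.2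
  -- The cubes reachable from `a` and the others form two closed sets covering `G`; a common point
  -- makes a cube of one kind a neighbor of one of the other.
  obtain ⟨y, -, hy1, hy2⟩ := isPreconnected_closed_iff.1 hG (F A) (F Aᶜ) (hF A) (hF Aᶜ) hsub
    ⟨ya, hya', Set.mem_biUnion (show a ∈ A from SimpleGraph.Reachable.refl _) hya⟩
    ⟨yb, hyb', Set.mem_biUnion (show b ∈ Aᶜ from hab) hyb⟩
  simp only [F, Set.mem_iUnion] at hy1 hy2
  obtain ⟨w1, hw1, h1⟩ := hy1
  obtain ⟨w2, hw2, h2⟩ := hy2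
  exact hw2 ((show (nbGraph W).Reachable a w1 from hw1).trans
    (nbGraph_reachable_of_neighbor ⟨y, h1, h2⟩))

/-- `Q` and `Q'` are joined in `𝒞` by a chain of at most `B + 1` neighbors. -/
def ShortWalk (𝒞 : Set (DyadicCube n)) (B : ℕ) (Q Q' : DyadicCube n) : Prop :=
  ∃ L ≤ B, ∃ f : ℕ → DyadicCube n, f 0 = Q ∧ f L = Q' ∧ (∀ i ≤ L, f i ∈ 𝒞) ∧
    ∀ i < L, (f i).Neighbor (f (i + 1))

lemma ShortWalk.mono {𝒞 𝒞' : Set (DyadicCube n)} {B B' : ℕ} {Q Q' : DyadicCube n}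
    (h : ShortWalk 𝒞 B Q Q') (h𝒞 : 𝒞 ⊆ 𝒞') (hB : B ≤ B') : ShortWalk 𝒞' B' Q Q' := by
  obtain ⟨L, hL, f, h0, h1, h2, h3⟩ := h
  exact ⟨L, hL.trans hB, f, h0, h1, fun i hi => h𝒞 (h2 i hi), h3⟩

/-- In a connected collection one reaches a set `T` by a chain of length at most the number of
cubes outside `T`. -/
lemma exists_shortWalk {W T : Set (DyadicCube n)} {D : ℕ} (a b : W)
    (hab : (nbGraph W).Reachable a b) (hb : b.1 ∈ T) (hfin : (W \ T).Finite)
    (hD : (W \ T).ncard ≤ D) : ∃ Q' ∈ W ∩ T, ShortWalk W D a Q' := by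
  classical
  obtain ⟨p, hp⟩ := hab.exists_isPath
  have hex : ∃ i, i ≤ p.length ∧ (p.getVert i).1 ∈ T :=
    ⟨p.length, le_rfl, by rwa [p.getVert_length]⟩
  -- At the first entry into `T`, the earlier vertices of the path are distinct and outside `T`, so
  -- their number is at most `D`.
  let L := Nat.find hex
  have hL : L ≤ p.length ∧ (p.getVert L).1 ∈ T := Nat.find_spec hex
  have hmin : ∀ i < L, (p.getVert i).1 ∉ T := fun i hi h =>
    Nat.find_min hex hi ⟨hi.le.trans hL.1, h⟩
  refine ⟨(p.getVert L).1, ⟨(p.getVert L).2, hL.2⟩, L, ?_, fun i => (p.getVert i).1, by simp,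
    rfl, fun i _ => (p.getVert i).2, fun i hi =>
      nbGraph_adj (p.adj_getVert_succ (hi.trans_le hL.1))⟩
  refine le_trans ?_ hD
  have : (Finset.range L : Set ℕ).ncard ≤ (W \ T).ncard := by
    refine Set.ncard_le_ncard_of_injOn (fun i => (p.getVert i).1) ?_ ?_ hfin
    · intro i hi
      exact ⟨(p.getVert i).2, hmin i (by simpa using hi)⟩
    · intro i hi j hj hij
      have hi : i < L := by simpa using hi
      have hj : j < L := by simpa using hj
      exact hp.getVert_injOn (by simp; omega) (by simp; omega) (Subtype.ext hij)
  simpa [Set.ncard_coe_finset] using this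

/-! ### Chains with geometrically decreasing sidelengths -/

/-- `Q` and `Q'` are joined in `𝒞` by a chain of neighbors whose sidelengths decrease
geometrically at rate `θ`, up to the factor `M`. -/
def DecayPath (𝒞 : Set (DyadicCube n)) (M θ : ℝ) (Q Q' : DyadicCube n) : Prop :=
  ∃ (L : ℕ) (f : ℕ → DyadicCube n), f 0 = Q ∧ f L = Q' ∧ (∀ i ≤ L, f i ∈ 𝒞) ∧
    (∀ i < L, (f i).Neighbor (f (i + 1))) ∧
    (∀ l k, l ≤ k → k ≤ L → (f k).side ≤ M * θ ^ (k - l) * (f l).side)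

lemma DecayPath.mono {𝒞 : Set (DyadicCube n)} {M M' θ : ℝ} {Q Q' : DyadicCube n} (hθ : 0 ≤ θ)
    (hM : M ≤ M') (h : DecayPath 𝒞 M θ Q Q') : DecayPath 𝒞 M' θ Q Q' := by
  obtain ⟨L, f, h0, h1, h2, h3, h4⟩ := h
  refine ⟨L, f, h0, h1, h2, h3, fun l k hlk hk => (h4 l k hlk hk).trans ?_⟩
  have := (f l).side_pos
  gcongr

/-- Concatenation of two chains, the first of length `L`. -/
def concatFun {α : Type*} (L : ℕ) (f g : ℕ → α) (i : ℕ) : α := if i ≤ L then f i else g (i - L)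

lemma concatFun_le {α : Type*} {L : ℕ} {f g : ℕ → α} {i : ℕ} (h : i ≤ L) :
    concatFun L f g i = f i := if_pos h

lemma concatFun_ge {α : Type*} {L : ℕ} {f g : ℕ → α} (hfg : f L = g 0) {i : ℕ} (h : L ≤ i) :
    concatFun L f g i = g (i - L) := by
  unfold concatFun
  split_ifs with h'
  · obtain rfl : i = L := by omega
    rw [hfg, Nat.sub_self]
  · rfl

lemma concatFun_mem {𝒞 : Set (DyadicCube n)} {L L' : ℕ} {f g : ℕ → DyadicCube n}
    (hf : ∀ i ≤ L, f i ∈ 𝒞) (hg : ∀ i ≤ L', g i ∈ 𝒞) :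
    ∀ i ≤ L + L', concatFun L f g i ∈ 𝒞 := by
  intro i hi
  unfold concatFun
  split_ifs with h
  · exact hf i h
  · exact hg _ (by omega)

lemma concatFun_neighbor {L L' : ℕ} {f g : ℕ → DyadicCube n} (hfg : f L = g 0)
    (hf : ∀ i < L, (f i).Neighbor (f (i + 1))) (hg : ∀ i < L', (g i).Neighbor (g (i + 1))) :
    ∀ i < L + L', (concatFun L f g i).Neighbor (concatFun L f g (i + 1)) := by
  intro i hi
  rcases lt_or_ge i L with h | h
  · rw [concatFun_le h.le, concatFun_le (by omega)]; exact hf i h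
  · rw [concatFun_ge hfg h, concatFun_ge hfg (by omega), Nat.sub_add_comm h]
    exact hg _ (by omega)

/-- The constants multiply, so this serves for boundedly many concatenations only; long chains need
`decayPath_of_halfSteps`. -/
lemma DecayPath.trans {𝒞 : Set (DyadicCube n)} {M M' θ : ℝ} {Q Q' Q'' : DyadicCube n}
    (hθ : 0 ≤ θ) (hM : 1 ≤ M) (hM' : 1 ≤ M')
    (h : DecayPath 𝒞 M θ Q Q') (h' : DecayPath 𝒞 M' θ Q' Q'') :
    DecayPath 𝒞 (M * M') θ Q Q'' := by
  obtain ⟨L, f, f0, fL, f2, f3, f4⟩ := h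
  obtain ⟨L', g, g0, gL, g2, g3, g4⟩ := h'
  have hfg : f L = g 0 := fL.trans g0.symm
  refine ⟨L + L', concatFun L f g, by rw [concatFun_le (by omega), f0],
    by rw [concatFun_ge hfg (by omega), Nat.add_sub_cancel_left, gL], concatFun_mem f2 g2,
    concatFun_neighbor hfg f3 g3, ?_⟩
  intro l k hlk hk
  have hs : ∀ Q : DyadicCube n, 0 ≤ Q.side := fun Q => Q.side_pos.le
  rcases le_or_gt k L with hkL | hkL
  · rw [concatFun_le hkL, concatFun_le (by omega)]
    refine (f4 l k hlk hkL).trans ?_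
    have : M ≤ M * M' := by nlinarith
    have := hs (f l)
    gcongr
  · rw [concatFun_ge hfg hkL.le]
    rcases le_or_gt l L with hlL | hlL
    · rw [concatFun_le hlL]
      have e1 := g4 0 (k - L) (by omega) (by omega)
      have e2 := f4 l L hlL le_rfl
      rw [← hfg] at e1
      calc (g (k - L)).side ≤ M' * θ ^ (k - L - 0) * (f L).side := e1
        _ ≤ M' * θ ^ (k - L - 0) * (M * θ ^ (L - l) * (f l).side) := by gcongr
        _ = M * M' * (θ ^ (k - L - 0) * θ ^ (L - l)) * (f l).side := by ring
        _ = _ := by rw [← pow_add]; congr 3; omega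
    · rw [concatFun_ge hfg hlL.le]
      refine (g4 (l - L) (k - L) (by omega) (by omega)).trans ?_
      have e : k - L - (l - L) = k - l := by omega
      rw [e]
      have : M' ≤ M * M' := by nlinarith
      have := hs (g (l - L))
      gcongr

lemma side_le_pow_of_chain {f : ℕ → DyadicCube n} {L : ℕ}
    (h : ∀ i < L, (f (i + 1)).side ≤ 2 * (f i).side ∧ (f i).side ≤ 2 * (f (i + 1)).side) :
    ∀ l k, l ≤ k → k ≤ L →
      (f k).side ≤ 2 ^ (k - l) * (f l).side ∧ (f l).side ≤ 2 ^ (k - l) * (f k).side := by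
  intro l k hlk
  induction k, hlk using Nat.le_induction with
  | base => intro _; simp
  | succ k hlk ih =>
    intro hk
    obtain ⟨h1, h2⟩ := ih (by omega)
    obtain ⟨h3, h4⟩ := h k (by omega)
    rw [Nat.sub_add_comm hlk, pow_succ]
    have : (0 : ℝ) < 2 ^ (k - l) := by positivity
    constructor
    · nlinarith
    · nlinarith

/-- The sidelengths of neighbors in `𝒞` differ at most by the factor two. -/
def Balanced (𝒞 : Set (DyadicCube n)) : Prop :=
  ∀ Q ∈ 𝒞, ∀ Q' ∈ 𝒞, Q.Neighbor Q' → Q'.side ≤ 2 * Q.side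

lemma Balanced.chain {𝒞 : Set (DyadicCube n)} (h𝒞 : Balanced 𝒞) {f : ℕ → DyadicCube n} {L : ℕ}
    (h2 : ∀ i ≤ L, f i ∈ 𝒞) (h3 : ∀ i < L, (f i).Neighbor (f (i + 1))) :
    ∀ l k, l ≤ k → k ≤ L →
      (f k).side ≤ 2 ^ (k - l) * (f l).side ∧ (f l).side ≤ 2 ^ (k - l) * (f k).side :=
  side_le_pow_of_chain fun i hi =>
    ⟨h𝒞 _ (h2 i hi.le) _ (h2 (i + 1) hi) (h3 i hi),
      h𝒞 _ (h2 (i + 1) hi) _ (h2 i hi.le) (h3 i hi).symm⟩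

/-- The rate of decrease along chains that halve the sidelength every `B` steps. -/
noncomputable def rate (B : ℕ) : ℝ := 1 - 1 / (2 * B)

/-- The last bound is Bernoulli's inequality. -/
lemma rate_bounds {B : ℕ} (hB : 1 ≤ B) : 1 / 2 ≤ rate B ∧ rate B < 1 ∧ 1 / 2 ≤ rate B ^ B := by
  have hB' : (1 : ℝ) ≤ B := by exact_mod_cast hB
  have h1 : 1 / (2 * (B : ℝ)) ≤ 1 / 2 := by
    apply one_div_le_one_div_of_le <;> linarith
  have h2 : 0 < 1 / (2 * (B : ℝ)) := by positivity
  refine ⟨by unfold rate; linarith, by unfold rate; linarith, ?_⟩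
  have := one_add_mul_le_pow (a := -(1 / (2 * (B : ℝ)))) (by linarith) B
  unfold rate
  have e : 1 + (B : ℝ) * -(1 / (2 * B)) = 1 / 2 := by field_simp; ring
  rw [e, ← sub_eq_add_neg] at this
  exact this

lemma half_le_rate_pow {B i : ℕ} (hB : 1 ≤ B) (hi : i ≤ B) : 1 / 2 ≤ rate B ^ i := by
  obtain ⟨h1, h2, h3⟩ := rate_bounds hB
  exact h3.trans (pow_le_pow_of_le_one (by linarith) h2.le hi)

/-- Within `B` steps the side grows at most by `2 ^ B` while the rate loses at most a factor two, so
the constant absorbs everything. -/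
lemma ShortWalk.decayPath {𝒞 : Set (DyadicCube n)} (h𝒞 : Balanced 𝒞) {B : ℕ} (hB : 1 ≤ B)
    {Q Q' : DyadicCube n} (h : ShortWalk 𝒞 B Q Q') :
    DecayPath 𝒞 (2 ^ (B + 1)) (rate B) Q Q' := by
  obtain ⟨L, hL, f, h0, h1, h2, h3⟩ := h
  refine ⟨L, f, h0, h1, h2, h3, fun l k hlk hk => ?_⟩
  have e1 := (h𝒞.chain h2 h3 l k hlk hk).1
  have e2 := half_le_rate_pow hB (show k - l ≤ B by omega)
  have hp := (f l).side_pos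
  have e3 : (2 : ℝ) ^ (k - l) ≤ 2 ^ B := pow_le_pow_right₀ (by norm_num) (by omega)
  calc (f k).side ≤ 2 ^ (k - l) * (f l).side := e1
    _ ≤ 2 ^ B * (f l).side := by gcongr
    _ = 2 ^ (B + 1) * (1 / 2) * (f l).side := by rw [pow_succ]; ring
    _ ≤ _ := by gcongr

/-- A short walk that at least halves the sidelength. -/
def HalfStep (𝒞 : Set (DyadicCube n)) (B : ℕ) (Q Q' : DyadicCube n) : Prop :=
  ShortWalk 𝒞 B Q Q' ∧ Q'.side ≤ Q.side / 2

lemma reflTransGen_halfStep_mono {𝒞 : Set (DyadicCube n)} {B B' : ℕ} (hB : B ≤ B')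
    {Q Q' : DyadicCube n} (h : Relation.ReflTransGen (HalfStep 𝒞 B) Q Q') :
    Relation.ReflTransGen (HalfStep 𝒞 B') Q Q' :=
  Relation.ReflTransGen.mono (fun _ _ hs => ⟨hs.1.mono subset_rfl hB, hs.2⟩) _ _ h

/-- Each halving pays for the at most `B` steps it takes, since `rate B ^ B ≥ 1 / 2`; hence the
constant does not depend on the number of half steps. -/
lemma decayPath_of_halfSteps {𝒞 : Set (DyadicCube n)} (h𝒞 : Balanced 𝒞) {B : ℕ} (hB : 1 ≤ B)
    {Q Q' : DyadicCube n} (hQ' : Q' ∈ 𝒞) (h : Relation.ReflTransGen (HalfStep 𝒞 B) Q Q') :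
    DecayPath 𝒞 (2 ^ (2 * B + 1)) (rate B) Q Q' := by
  obtain ⟨hr1, hr2, hr3⟩ := rate_bounds hB
  -- The bound from the starting cube, with the better constant `2 ^ (B + 1)`, is reproduced when a
  -- half step is prepended. Bounds from a cube inside that half step lose a further `2 ^ B`.
  suffices H : ∃ (L : ℕ) (f : ℕ → DyadicCube n), f 0 = Q ∧ f L = Q' ∧ (∀ i ≤ L, f i ∈ 𝒞) ∧
      (∀ i < L, (f i).Neighbor (f (i + 1))) ∧
      (∀ k ≤ L, (f k).side ≤ 2 ^ (B + 1) * rate B ^ k * Q.side) ∧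
      (∀ l k, l ≤ k → k ≤ L → (f k).side ≤ 2 ^ (2 * B + 1) * rate B ^ (k - l) * (f l).side) by
    obtain ⟨L, f, h0, h1, h2, h3, -, h4⟩ := H
    exact ⟨L, f, h0, h1, h2, h3, h4⟩
  induction h using Relation.ReflTransGen.head_induction_on with
  | refl =>
    have hs := Q'.side_pos
    have e1 : (1 : ℝ) ≤ 2 ^ (B + 1) := one_le_pow₀ (by norm_num)
    have e2 : (1 : ℝ) ≤ 2 ^ (2 * B + 1) := one_le_pow₀ (by norm_num)
    refine ⟨0, fun _ => Q', rfl, rfl, fun _ _ => hQ', by simp, ?_, ?_⟩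
    · intro k hk
      obtain rfl : k = 0 := by omega
      rw [pow_zero, mul_one]; nlinarith
    · intro l k hlk hk
      obtain rfl : k = 0 := by omega
      obtain rfl : l = 0 := by omega
      rw [Nat.sub_zero, pow_zero, mul_one]; nlinarith
  | @head Q Q₁ hstep _ ih =>
    obtain ⟨⟨L, hLB, f, f0, fL, f2, f3⟩, hhalf⟩ := hstep
    obtain ⟨L', g, g0, gL, g2, g3, g5, g4⟩ := ih
    have hfg : f L = g 0 := fL.trans g0.symm
    have hch := h𝒞.chain f2 f3
    have hQ := Q.side_pos
    have key : ∀ k ≤ L + L', (concatFun L f g k).side ≤ 2 ^ (B + 1) * rate B ^ k * Q.side := by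
      intro k hk
      rcases le_or_gt k L with hkL | hkL
      · rw [concatFun_le hkL]
        have e1 := (hch 0 k (by omega) hkL).1
        rw [f0, Nat.sub_zero] at e1
        have e2 := half_le_rate_pow hB (show k ≤ B by omega)
        have e3 : (2 : ℝ) ^ k ≤ 2 ^ B := pow_le_pow_right₀ (by norm_num) (by omega)
        calc (f k).side ≤ 2 ^ k * Q.side := e1
          _ ≤ 2 ^ B * Q.side := by gcongr
          _ = 2 ^ (B + 1) * (1 / 2) * Q.side := by rw [pow_succ]; ring
          _ ≤ _ := by gcongr
      · rw [concatFun_ge hfg hkL.le]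
        have e2 := half_le_rate_pow hB hLB
        have e4 : 0 < rate B ^ (k - L) := by positivity
        calc (g (k - L)).side ≤ 2 ^ (B + 1) * rate B ^ (k - L) * Q₁.side := g5 _ (by omega)
          _ ≤ 2 ^ (B + 1) * rate B ^ (k - L) * (1 / 2 * Q.side) := by
            gcongr; linarith
          _ ≤ 2 ^ (B + 1) * rate B ^ (k - L) * (rate B ^ L * Q.side) := by gcongr
          _ = 2 ^ (B + 1) * (rate B ^ (k - L) * rate B ^ L) * Q.side := by ring
          _ = _ := by rw [← pow_add, Nat.sub_add_cancel hkL.le]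
    refine ⟨L + L', concatFun L f g, by rw [concatFun_le (by omega), f0],
      by rw [concatFun_ge hfg (by omega), Nat.add_sub_cancel_left, gL], concatFun_mem f2 g2,
      concatFun_neighbor hfg f3 g3, key, ?_⟩
    intro l k hlk hk
    rcases le_or_gt l L with hlL | hlL
    · have e1 := key k hk
      rw [concatFun_le hlL]
      have e2 := (hch 0 l (by omega) hlL).2
      rw [f0, Nat.sub_zero] at e2
      have e3 : (2 : ℝ) ^ l ≤ 2 ^ B := pow_le_pow_right₀ (by norm_num) (by omega)
      have hfl := (f l).side_pos
      have e5 : rate B ^ k ≤ rate B ^ (k - l) :=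
        pow_le_pow_of_le_one (by linarith) hr2.le (by omega)
      have e6 : 0 < rate B ^ (k - l) := by positivity
      calc (concatFun L f g k).side ≤ 2 ^ (B + 1) * rate B ^ k * Q.side := e1
        _ ≤ 2 ^ (B + 1) * rate B ^ (k - l) * (2 ^ B * (f l).side) := by
          gcongr
          exact e2.trans (by gcongr)
        _ = _ := by rw [show 2 * B + 1 = (B + 1) + B by ring, pow_add]; ring
    · rw [concatFun_ge hfg hlL.le, concatFun_ge hfg (by omega)]
      have e := g4 (l - L) (k - L) (by omega) (by omega)
      rwa [show k - L - (l - L) = k - l by omega] at e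

lemma DyadicCube.unit_side (n : ℕ) : (DyadicCube.unit n).side = 1 := by
  simp [DyadicCube.side, DyadicCube.unit]

lemma DyadicCube.norm_sub_center_le_of_mem_dilate {Q : DyadicCube n} {A : ℝ} (hA : 0 ≤ A)
    {x : Fin n → ℝ} (hx : x ∈ Q.dilate A) : ‖x - Q.center‖ ≤ A * Q.side / 2 := by
  have hs := Q.side_pos
  rw [pi_norm_le_iff_of_nonneg (by positivity)]
  intro i
  rw [Real.norm_eq_abs, abs_le, Pi.sub_apply]
  constructor <;> linarith [(hx i).1, (hx i).2]

lemma DyadicCube.mem_dilate_of_norm_lt {Q : DyadicCube n} {A : ℝ}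
    {x : Fin n → ℝ} (hx : ‖x - Q.center‖ < A * Q.side / 2) : x ∈ Q.dilate A := by
  intro i
  have := (norm_le_pi_norm (x - Q.center) i).trans_lt hx
  rw [Real.norm_eq_abs, abs_lt, Pi.sub_apply] at this
  constructor <;> linarith [this.1, this.2]

/-! ### Families with the geometry of a Calderón–Zygmund decomposition -/

/-- The geometric properties of the decomposition `CZ°`: a finite family of dyadic subcubes that
covers the unit cube, with sidelengths varying slowly in a quantitative sense, each close to a
point of `E`. -/
structure IsWhitney (𝒞 : Set (DyadicCube n)) (E : Finset (Fin n → ℝ)) : Prop where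
  finite : 𝒞.Finite
  cover : ∀ y ∈ (DyadicCube.unit n).toSet, ∃ Q ∈ 𝒞, y ∈ Q.toSet
  sub : ∀ Q ∈ 𝒞, Q.toSet ⊆ (DyadicCube.unit n).toSet
  slow : ∀ Q ∈ 𝒞, ∀ Q' ∈ 𝒞, Q'.side < 2 / 3 * ‖Q.center - Q'.center‖ + 7 / 3 * Q.side
  near : ∀ Q ∈ 𝒞, ∃ x ∈ E, ‖x - Q.center‖ ≤ 7 / 2 * Q.side
  side_le : ∀ Q ∈ 𝒞, Q.side ≤ 1 / 2
  center : ∀ x ∈ E, ‖x - (DyadicCube.unit n).center‖ ≤ 1 / 16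

namespace IsWhitney

variable {𝒞 : Set (DyadicCube n)} {E : Finset (Fin n → ℝ)}

/-- For neighbors the center distance is at most the mean of the sides, so `slow` gives a ratio
below four. -/
lemma balanced (h : IsWhitney 𝒞 E) : Balanced 𝒞 := by
  intro Q hQ Q' hQ' hn
  apply DyadicCube.side_le_two_mul_of_lt
  have := h.slow Q hQ Q' hQ'
  linarith [hn.norm_le]

lemma center_mem (h : IsWhitney 𝒞 E) {Q : DyadicCube n} (hQ : Q ∈ 𝒞) :
    Q.center ∈ (DyadicCube.unit n).toSet := h.sub Q hQ Q.center_mem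

/-- The number of neighbors of a cube is bounded. -/
lemma exists_degree_bound (n : ℕ) : ∃ D : ℕ, ∀ (𝒞 : Set (DyadicCube n)) (E : Finset (Fin n → ℝ)),
    IsWhitney 𝒞 E → ∀ Q ∈ 𝒞, {Q' ∈ 𝒞 | Q.Neighbor Q'}.ncard ≤ D := by
  obtain ⟨D, hD⟩ := DyadicCube.exists_packing n 4
  refine ⟨D, fun 𝒞 E h Q hQ => (hD _ (Q.side / 2) Q.center (by linarith [Q.side_pos]) ?_).2⟩
  rintro Q' ⟨hQ', hn⟩
  have h1 := h.balanced Q hQ Q' hQ' hn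
  have h2 := h.balanced Q' hQ' Q hQ hn.symm
  have h3 := hn.symm.norm_le
  refine ⟨by linarith, by linarith, by linarith⟩

/-- Within a connected subset of the unit cube, one reaches a set `T` of cubes by a bounded number
of steps if the cubes outside `T` that meet the subset are of comparable size and location. -/
lemma exists_walk_bound (n : ℕ) (K : ℝ) : ∃ D : ℕ, ∀ (𝒞 : Set (DyadicCube n))
    (E : Finset (Fin n → ℝ)), IsWhitney 𝒞 E → ∀ (G : Set (Fin n → ℝ)), IsPreconnected G →
    G ⊆ (DyadicCube.unit n).toSet → ∀ (T : Set (DyadicCube n)) (a : ℝ) (z : Fin n → ℝ), 0 < a →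
    (∀ Q ∈ meeting 𝒞 G, Q ∉ T → a ≤ Q.side ∧ Q.side ≤ K * a ∧ ‖Q.center - z‖ ≤ K * a) →
    ∀ Q ∈ meeting 𝒞 G, ∀ Q' ∈ meeting 𝒞 G, Q' ∈ T →
    ∃ Q'' ∈ meeting 𝒞 G, Q'' ∈ T ∧ ShortWalk 𝒞 D Q Q'' := by
  obtain ⟨D, hD⟩ := DyadicCube.exists_packing n K
  refine ⟨D, fun 𝒞 E h G hG hsub T a z ha hT Q hQ Q' hQ' hQ'T => ?_⟩
  obtain ⟨h1, h2⟩ := hD (meeting 𝒞 G \ T) a z ha fun Q hQ => hT Q hQ.1 hQ.2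
  have hreach := nbGraph_meeting_reachable h.finite hG (fun y hy => by
    obtain ⟨Q, hQ, hy⟩ := h.cover y (hsub hy)
    exact ⟨Q, hQ, subset_closure hy⟩) ⟨Q, hQ⟩ ⟨Q', hQ'⟩
  obtain ⟨Q'', hQ'', hw⟩ := exists_shortWalk _ _ hreach hQ'T h1 h2
  exact ⟨Q'', hQ''.1, hQ''.2, hw.mono (fun Q hQ => hQ.1) le_rfl⟩

/-- From a cube that is not a keystone cube, a bounded number of steps leads to a cube of at most
half the sidelength. -/
lemma exists_halfStep (n : ℕ) : ∃ B : ℕ, ∀ (𝒞 : Set (DyadicCube n)) (E : Finset (Fin n → ℝ)),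
    IsWhitney 𝒞 E → ∀ Q ∈ 𝒞, Q ∉ keystone 𝒞 → ∃ Q' ∈ 𝒞, HalfStep 𝒞 B Q Q' := by
  obtain ⟨D, hD⟩ := exists_walk_bound n 100
  refine ⟨D, fun 𝒞 E h Q hQ hkey => ?_⟩
  have hs := Q.side_pos
  simp only [keystone, Set.mem_ofPred_eq, not_and, not_forall, not_le] at hkey
  obtain ⟨Q', hQ', ⟨y, hyQ', hyQ⟩, hlt⟩ := hkey hQ
  have hy := DyadicCube.norm_sub_center_le_of_mem_dilate (by norm_num) hyQ
  let G := (DyadicCube.unit n).toSet ∩ Metric.closedBall Q.center (50 * Q.side)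
  have hG : IsPreconnected G :=
    ((DyadicCube.unit n).convex_toSet.inter (convex_closedBall _ _)).isPreconnected
  -- The walk stops at the first cube smaller than `Q`; the cubes before it are at least as large as
  -- `Q`, and by `slow` not much larger.
  obtain ⟨Q'', hQ''G, hQ''T, hw⟩ := hD 𝒞 E h G hG Set.inter_subset_left {R | R.side < Q.side}
    Q.side Q.center hs (by
      rintro R ⟨hR, w, hw1, -, hw2⟩ hRT
      rw [Set.mem_ofPred_eq, not_lt] at hRT
      rw [mem_closedBall_iff_norm] at hw2
      have h1 := DyadicCube.norm_sub_center_le hw1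
      have h2 := h.slow Q hQ R hR
      have h3 : ‖R.center - Q.center‖ ≤ R.side / 2 + 50 * Q.side :=
        calc ‖R.center - Q.center‖ = ‖(w - Q.center) - (w - R.center)‖ := by congr 1; abel
          _ ≤ _ := norm_sub_le _ _
          _ ≤ _ := by linarith
      rw [norm_sub_rev] at h2
      refine ⟨hRT, by linarith, by linarith⟩)
    Q ⟨hQ, Q.center, subset_closure Q.center_mem, h.center_mem hQ,
      Metric.mem_closedBall_self (by positivity)⟩
    Q' ⟨hQ', y, subset_closure hyQ', h.sub Q' hQ' hyQ', by
      rw [mem_closedBall_iff_norm]; linarith⟩ hlt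
  exact ⟨Q'', hQ''G.1, hw, DyadicCube.side_le_half_of_lt hQ''T⟩

/-- Every cube is joined to a keystone cube by short walks that halve the sidelength. -/
lemma exists_keystone (n : ℕ) : ∃ B : ℕ, ∀ (𝒞 : Set (DyadicCube n)) (E : Finset (Fin n → ℝ)),
    IsWhitney 𝒞 E → ∀ Q ∈ 𝒞, ∃ K ∈ keystone 𝒞, Relation.ReflTransGen (HalfStep 𝒞 B) Q K ∧
      (Q ∈ keystone 𝒞 → K = Q) := by
  obtain ⟨B, hB⟩ := exists_halfStep n
  refine ⟨B, fun 𝒞 E h => ?_⟩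
  suffices H : ∀ N : ℕ, ∀ Q ∈ 𝒞, {Q' ∈ 𝒞 | Q'.side < Q.side}.ncard = N →
      ∃ K ∈ keystone 𝒞, Relation.ReflTransGen (HalfStep 𝒞 B) Q K ∧ (Q ∈ keystone 𝒞 → K = Q) from
    fun Q hQ => H _ Q hQ rfl
  intro N
  induction N using Nat.strong_induction_on with
  | _ N ih =>
    intro Q hQ hN
    by_cases hkey : Q ∈ keystone 𝒞
    · exact ⟨Q, hkey, Relation.ReflTransGen.refl, fun _ => rfl⟩
    · obtain ⟨Q₁, hQ₁, hstep⟩ := hB 𝒞 E h Q hQ hkey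
      have hlt : Q₁.side < Q.side := by linarith [hstep.2, Q.side_pos]
      obtain ⟨K, hK, hp, -⟩ := ih _ (by
        rw [← hN]
        refine Set.ncard_lt_ncard ⟨fun R hR => ⟨hR.1, hR.2.trans hlt⟩, fun hsub => ?_⟩
          (h.finite.subset fun R hR => hR.1)
        exact lt_irrefl _ (hsub ⟨hQ₁, hlt⟩).2) Q₁ hQ₁ rfl
      exact ⟨K, hK, hp.head hstep, fun h => absurd h hkey⟩

/-! ### Exceptional cubes -/

/-- The point `x` lies in a cube of `𝒞` of sidelength less than a hundredth of that of `Q`. -/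
def HasSmallCube (𝒞 : Set (DyadicCube n)) (Q : DyadicCube n) (x : Fin n → ℝ) : Prop :=
  ∃ R ∈ 𝒞, x ∈ R.toSet ∧ 100 * R.side < Q.side

/-- The cubes of `𝒞` around which `E` is a single small cluster, near which there are much smaller
cubes of `𝒞`. -/
def interstitial (𝒞 : Set (DyadicCube n)) (E : Finset (Fin n → ℝ)) : Set (DyadicCube n) :=
  {Q ∈ 𝒞 | (∀ x ∈ E, ‖x - Q.center‖ ≤ 4 * Q.side → HasSmallCube 𝒞 Q x) ∧
    ∀ x ∈ E, ∀ y ∈ E, ‖x - Q.center‖ ≤ 16 * Q.side → ‖y - Q.center‖ ≤ 16 * Q.side →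
      ‖x - y‖ < Q.side / 32}

lemma mem_unit_of_mem (h : IsWhitney 𝒞 E) {x : Fin n → ℝ} {r : ℝ} (hx : x ∈ E) (hr : r ≤ 1 / 8)
    {y : Fin n → ℝ} (hy : ‖y - x‖ ≤ r) : y ∈ (DyadicCube.unit n).toSet := by
  rw [DyadicCube.mem_toSet_iff, DyadicCube.unit_side]
  have h1 := h.center x hx
  have : ‖y - (DyadicCube.unit n).center‖ ≤ 1 / 4 :=
    calc ‖y - (DyadicCube.unit n).center‖
        = ‖(y - x) + (x - (DyadicCube.unit n).center)‖ := by congr 1; abel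
      _ ≤ _ := norm_add_le _ _
      _ ≤ _ := by linarith
  intro i
  have := (norm_le_pi_norm _ i).trans this
  rw [Real.norm_eq_abs, abs_le, Pi.sub_apply] at this
  constructor <;> linarith [this.1, this.2]

lemma exists_mem_cube (h : IsWhitney 𝒞 E) {x : Fin n → ℝ} (hx : x ∈ E) :
    ∃ Q ∈ 𝒞, x ∈ Q.toSet :=
  h.cover x (h.mem_unit_of_mem (r := 0) hx (by norm_num) (by simp))

/-- The number of the cubes that are not interstitial is bounded by a multiple of the number of
the points of `E`. -/
lemma exists_card_exceptional (n : ℕ) : ∃ D : ℕ, ∀ (𝒞 : Set (DyadicCube n))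
    (E : Finset (Fin n → ℝ)), IsWhitney 𝒞 E →
    (𝒞 \ interstitial 𝒞 E).ncard ≤ D * E.card := by
  obtain ⟨D₁, hD₁⟩ := DyadicCube.exists_charging n 3200
  obtain ⟨D₂, hD₂⟩ := DyadicCube.exists_charging n 262144
  refine ⟨D₁ + D₂, fun 𝒞 E h => ?_⟩
  have hcube : ∀ x : Fin n → ℝ, ∃ R : DyadicCube n, x ∈ E → R ∈ 𝒞 ∧ x ∈ R.toSet := by
    intro x
    by_cases hx : x ∈ E
    · obtain ⟨R, hR⟩ := h.exists_mem_cube hx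
      exact ⟨R, fun _ => hR⟩
    · exact ⟨DyadicCube.unit n, fun h => absurd h hx⟩
  choose R hR using hcube
  let S₁ : Set (DyadicCube n) := {Q ∈ 𝒞 | ∃ x ∈ E, ‖x - Q.center‖ ≤ 4 * Q.side ∧
    Q.side ≤ 100 * (R x).side}
  let S₂ : Set (DyadicCube n) := {Q ∈ 𝒞 | ∃ x ∈ E, ∃ y ∈ E, ‖x - Q.center‖ ≤ 16 * Q.side ∧
    ‖y - Q.center‖ ≤ 16 * Q.side ∧ Q.side / 32 ≤ ‖x - y‖}
  have hsub : 𝒞 \ interstitial 𝒞 E ⊆ S₁ ∪ S₂ := by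
    rintro Q ⟨hQ, hni⟩
    by_contra hcon
    refine hni ⟨hQ, fun x hx hxQ => ⟨R x, (hR x hx).1, (hR x hx).2, ?_⟩,
      fun x hx y hy hxQ hyQ => ?_⟩
    · by_contra hlt
      exact hcon (Or.inl ⟨hQ, x, hx, hxQ, not_lt.1 hlt⟩)
    · by_contra hlt
      exact hcon (Or.inr ⟨hQ, x, hx, y, hy, hxQ, hyQ, not_lt.1 hlt⟩)
  -- By `slow` the cube containing `x` has side less than `8 * Q.side`, which makes the charging
  -- scale a lower bound for `Q.side`.
  have h₁ := hD₁ S₁ E (fun x => (R x).side / 8) (by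
    rintro Q ⟨hQ, x, hx, hxQ, hle⟩
    have hs := (R x).side_pos
    have h1 := h.slow Q hQ (R x) (hR x hx).1
    have h2 := DyadicCube.norm_sub_center_le_of_mem (hR x hx).2
    have h3 : ‖Q.center - (R x).center‖ ≤ 4 * Q.side + (R x).side / 2 :=
      calc ‖Q.center - (R x).center‖ = ‖(x - (R x).center) - (x - Q.center)‖ := by congr 1; abel
        _ ≤ _ := norm_sub_le _ _
        _ ≤ _ := by linarith
    rw [norm_sub_rev] at hxQ
    refine ⟨x, hx, by linarith, by linarith, by linarith, by linarith⟩)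
  obtain ⟨r, hr1, hr2⟩ := exists_net_weight E 1
  have h₂ := hD₂ S₂ E (fun x => r x / 64) (by
    rintro Q ⟨hQ, x, hx, y, hy, hxQ, hyQ, hle⟩
    have hs := Q.side_pos
    have hs1 := h.side_le Q hQ
    have hnear : ∀ x ∈ E, ‖x - Q.center‖ ≤ 16 * Q.side → ∃ z ∈ E, Q.side / 128 < r z ∧
        ‖x - z‖ ≤ Q.side / 128 ∧ ‖Q.center - z‖ ≤ 17 * Q.side := by
      intro x hx hxQ
      -- At this scale the two separated points have different net points. The smaller of their
      -- weights is at most their distance, hence comparable to `Q.side`, and `Q` is charged to that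
      -- net point.
      obtain ⟨z, hz, hzr, hxz⟩ := hr2 (Q.side / 128) (by positivity) (by linarith) x hx
      rw [dist_eq_norm] at hxz
      refine ⟨z, hz, hzr, hxz, ?_⟩
      calc ‖Q.center - z‖ = ‖(x - z) - (x - Q.center)‖ := by congr 1; abel
        _ ≤ _ := norm_sub_le _ _
        _ ≤ _ := by linarith
    obtain ⟨x', hx', hx'r, hxx', hx'Q⟩ := hnear x hx hxQ
    obtain ⟨y', hy', hy'r, hyy', hy'Q⟩ := hnear y hy hyQ
    have hne : x' ≠ y' := by
      rintro rfl
      have : ‖x - y‖ ≤ Q.side / 64 :=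
        calc ‖x - y‖ = ‖(x - x') - (y - x')‖ := by congr 1; abel
          _ ≤ _ := norm_sub_le _ _
          _ ≤ _ := by linarith
      linarith
    have hd : dist x' y' ≤ 34 * Q.side := by
      rw [dist_eq_norm]
      calc ‖x' - y'‖ = ‖(Q.center - y') - (Q.center - x')‖ := by congr 1; abel
        _ ≤ _ := norm_sub_le _ _
        _ ≤ _ := by linarith
    have hmin := (hr1 x' hx' y' hy' hne).trans hd
    rcases min_le_iff.1 hmin with hm | hm
    · exact ⟨x', hx', by linarith, by linarith, by linarith, by linarith⟩
    · exact ⟨y', hy', by linarith, by linarith, by linarith, by linarith⟩)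
  calc (𝒞 \ interstitial 𝒞 E).ncard ≤ (S₁ ∪ S₂).ncard :=
        Set.ncard_le_ncard hsub (h₁.1.union h₂.1)
    _ ≤ S₁.ncard + S₂.ncard := Set.ncard_union_le _ _
    _ ≤ D₁ * E.card + D₂ * E.card := add_le_add h₁.2 h₂.2
    _ = _ := by ring

end IsWhitney

/-! ### Interstitial cubes -/

/-- Seen from `Q`, the set `E` is a cluster around its point `x`, and the cubes of `𝒞` at distance
at least `r` from `x` have sidelengths comparable to this distance. -/
structure IsPole (𝒞 : Set (DyadicCube n)) (E : Finset (Fin n → ℝ)) (Q : DyadicCube n)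
    (x : Fin n → ℝ) (r : ℝ) : Prop where
  mem : x ∈ E
  pos : 0 < r
  le : r ≤ Q.side / 4
  close : ‖Q.center - x‖ ≤ 4 * Q.side
  far : Q.side ≤ ‖Q.center - x‖
  cube : ∃ R ∈ 𝒞, x ∈ R.toSet ∧ 4 * R.side ≤ r
  cluster : ∀ e ∈ E, ‖e - Q.center‖ ≤ 16 * Q.side → 2 * ‖e - x‖ ≤ r

/-- The points of `E` near the cube `Q`. -/
noncomputable def nearPoints (E : Finset (Fin n → ℝ)) (Q : DyadicCube n) : Finset (Fin n → ℝ) :=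
  E.filter fun x => ‖x - Q.center‖ ≤ 16 * Q.side

/-- The radial projection to the sphere of radius `r` about `x`. -/
noncomputable def radialProj (x : Fin n → ℝ) (r : ℝ) (y : Fin n → ℝ) : Fin n → ℝ :=
  x + (r / ‖y - x‖) • (y - x)

lemma norm_radialProj_sub {x y : Fin n → ℝ} {r : ℝ} (hr : 0 ≤ r) (hy : y ≠ x) :
    ‖radialProj x r y - x‖ = r := by
  have : 0 < ‖y - x‖ := norm_pos_iff.2 (sub_ne_zero.2 hy)
  rw [radialProj, add_sub_cancel_left, norm_smul, Real.norm_of_nonneg (by positivity)]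
  field_simp

lemma continuousOn_radialProj (x : Fin n → ℝ) (r : ℝ) :
    ContinuousOn (radialProj x r) {y | y ≠ x} := by
  have h : ContinuousOn (fun y => r / ‖y - x‖) {y | y ≠ x} :=
    ContinuousOn.div₀ (by fun_prop) (by fun_prop) fun y hy =>
      (norm_pos_iff.2 (sub_ne_zero.2 hy)).ne'
  unfold radialProj
  fun_prop

/-- The cubes of `𝒞` whose closure meets the sphere of radius `r` about `x`. -/
def sphereCubes (𝒞 : Set (DyadicCube n)) (x : Fin n → ℝ) (r : ℝ) : Set (DyadicCube n) :=
  meeting 𝒞 {y | ‖y - x‖ = r}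

/-- The cubes of the sphere connected to the radial projection of `Q`. -/
def sphereComponent (𝒞 : Set (DyadicCube n)) (x : Fin n → ℝ) (r : ℝ) (Q : DyadicCube n) :
    Set (DyadicCube n) :=
  {Q' | ∃ (h' : Q' ∈ sphereCubes 𝒞 x r) (Q₁ : DyadicCube n) (h₁ : Q₁ ∈ sphereCubes 𝒞 x r),
    (closure Q₁.toSet ∩ radialProj x r '' closure Q.toSet).Nonempty ∧
    (nbGraph (sphereCubes 𝒞 x r)).Reachable ⟨Q₁, h₁⟩ ⟨Q', h'⟩}

namespace IsPole

variable {𝒞 : Set (DyadicCube n)} {E : Finset (Fin n → ℝ)} {Q Q' : DyadicCube n}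
  {x : Fin n → ℝ} {r : ℝ}

/-- A cube at `y` much smaller than `‖y - x‖` would have a point of `E` close to `y`, away from the
cluster. The upper bound is `slow` applied to the small cube containing `x`. -/
lemma side_bounds (h : IsWhitney 𝒞 E) (hx : IsPole 𝒞 E Q x r) (hQ' : Q' ∈ 𝒞) {y : Fin n → ℝ}
    (hy : y ∈ closure Q'.toSet) (h1 : r ≤ ‖y - x‖) (h2 : ‖y - x‖ ≤ 4 * Q.side) :
    ‖y - x‖ / 8 ≤ Q'.side ∧ Q'.side ≤ 2 * ‖y - x‖ := by
  have hyQ' := DyadicCube.norm_sub_center_le hy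
  have hr := hx.pos
  constructor
  · by_contra hlt
    rw [not_le] at hlt
    obtain ⟨e, he, heQ'⟩ := h.near Q' hQ'
    have hey : ‖e - y‖ ≤ 4 * Q'.side :=
      calc ‖e - y‖ = ‖(e - Q'.center) - (y - Q'.center)‖ := by congr 1; abel
        _ ≤ _ := norm_sub_le _ _
        _ ≤ _ := by linarith
    have heQ : ‖e - Q.center‖ ≤ 16 * Q.side :=
      calc ‖e - Q.center‖ = ‖(e - y) + ((y - x) - (Q.center - x))‖ := by congr 1; abel
        _ ≤ ‖e - y‖ + (‖y - x‖ + ‖Q.center - x‖) :=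
          (norm_add_le _ _).trans (by gcongr; exact norm_sub_le _ _)
        _ ≤ _ := by linarith [hx.close]
    have := hx.cluster e he heQ
    have h3 : ‖y - x‖ ≤ ‖e - x‖ + ‖e - y‖ :=
      calc ‖y - x‖ = ‖(e - x) - (e - y)‖ := by congr 1; abel
        _ ≤ _ := norm_sub_le _ _
    linarith
  · obtain ⟨R, hR, hxR, hRr⟩ := hx.cube
    have h3 := h.slow R hR Q' hQ'
    have h4 := DyadicCube.norm_sub_center_le_of_mem hxR
    have h5 : ‖R.center - Q'.center‖ ≤ Q'.side / 2 + ‖y - x‖ + R.side / 2 :=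
      calc ‖R.center - Q'.center‖ = ‖(y - Q'.center) - (y - x) - (x - R.center)‖ := by
            congr 1; abel
        _ ≤ ‖y - Q'.center‖ + ‖y - x‖ + ‖x - R.center‖ :=
          (norm_sub_le _ _).trans (by gcongr; exact norm_sub_le _ _)
        _ ≤ _ := by linarith
    linarith

lemma center_bound (h : IsWhitney 𝒞 E) (hx : IsPole 𝒞 E Q x r) (hQ' : Q' ∈ 𝒞) {y : Fin n → ℝ}
    (hy : y ∈ closure Q'.toSet) (h1 : r ≤ ‖y - x‖) (h2 : ‖y - x‖ ≤ 4 * Q.side) :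
    ‖Q'.center - x‖ ≤ 2 * ‖y - x‖ := by
  have h3 := (hx.side_bounds h hQ' hy h1 h2).2
  have h4 := DyadicCube.norm_sub_center_le hy
  calc ‖Q'.center - x‖ = ‖(y - x) - (y - Q'.center)‖ := by congr 1; abel
    _ ≤ _ := norm_sub_le _ _
    _ ≤ _ := by linarith

lemma ne_of_mem_closure (hx : IsPole 𝒞 E Q x r) {y : Fin n → ℝ} (hy : y ∈ closure Q.toSet) :
    y ≠ x := by
  rintro rfl
  have := DyadicCube.norm_sub_center_le hy
  rw [norm_sub_rev] at this
  linarith [hx.far, Q.side_pos]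

lemma sphere_subset_unit (h : IsWhitney 𝒞 E) (hQ : Q ∈ 𝒞) (hx : IsPole 𝒞 E Q x r) :
    {y | ‖y - x‖ = r} ⊆ (DyadicCube.unit n).toSet := fun _ hy =>
  h.mem_unit_of_mem hx.mem (r := r) (by linarith [hx.le, h.side_le Q hQ]) (le_of_eq hy)

/-- The radial projections of two neighbors are met by cubes that are connected in the sphere. -/
lemma reachable (h : IsWhitney 𝒞 E) (hQ : Q ∈ 𝒞) (hx : IsPole 𝒞 E Q x r)
    (hx' : IsPole 𝒞 E Q' x r) (hn : Q.Neighbor Q') {Q₁ Q₂ : DyadicCube n}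
    (h₁ : Q₁ ∈ sphereCubes 𝒞 x r) (h₂ : Q₂ ∈ sphereCubes 𝒞 x r)
    (hm₁ : (closure Q₁.toSet ∩ radialProj x r '' closure Q.toSet).Nonempty)
    (hm₂ : (closure Q₂.toSet ∩ radialProj x r '' closure Q'.toSet).Nonempty) :
    (nbGraph (sphereCubes 𝒞 x r)).Reachable ⟨Q₁, h₁⟩ ⟨Q₂, h₂⟩ := by
  let G := radialProj x r '' (closure Q.toSet ∪ closure Q'.toSet)
  have hne : ∀ y ∈ closure Q.toSet ∪ closure Q'.toSet, y ≠ x := by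
    rintro y (hy | hy)
    · exact hx.ne_of_mem_closure hy
    · exact hx'.ne_of_mem_closure hy
  have hGs : G ⊆ {y | ‖y - x‖ = r} := by
    rintro _ ⟨y, hy, rfl⟩
    exact norm_radialProj_sub hx.pos.le (hne y hy)
  have hG : IsPreconnected G := by
    obtain ⟨y, hy, hy'⟩ := hn
    exact (IsPreconnected.union y hy hy' Q.isPreconnected_closure
      Q'.isPreconnected_closure).image _ ((continuousOn_radialProj x r).mono hne)
  have hsub : meeting 𝒞 G ⊆ sphereCubes 𝒞 x r := fun R hR =>
    ⟨hR.1, hR.2.mono (Set.inter_subset_inter_right _ hGs)⟩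
  have hreach := nbGraph_meeting_reachable h.finite hG (fun y hy => by
    obtain ⟨Q, hQ, hy⟩ := h.cover y (hx.sphere_subset_unit h hQ (hGs hy))
    exact ⟨Q, hQ, subset_closure hy⟩)
    ⟨Q₁, h₁.1, hm₁.mono (Set.inter_subset_inter_right _
      (Set.image_mono Set.subset_union_left))⟩
    ⟨Q₂, h₂.1, hm₂.mono (Set.inter_subset_inter_right _
      (Set.image_mono Set.subset_union_right))⟩
  exact nbGraph_reachable_mono hsub hreach

lemma radialProj_center_mem (hx : IsPole 𝒞 E Q x r) :
    radialProj x r Q.center ∈ {y | ‖y - x‖ = r} ∩ radialProj x r '' closure Q.toSet :=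
  ⟨norm_radialProj_sub hx.pos.le (hx.ne_of_mem_closure (subset_closure Q.center_mem)),
    Q.center, subset_closure Q.center_mem, rfl⟩

lemma sphereComponent_nonempty (h : IsWhitney 𝒞 E) (hQ : Q ∈ 𝒞) (hx : IsPole 𝒞 E Q x r) :
    (sphereComponent 𝒞 x r Q).Nonempty := by
  obtain ⟨hc1, hc2⟩ := hx.radialProj_center_mem
  obtain ⟨Q₁, hQ₁, hy⟩ := h.cover _ (hx.sphere_subset_unit h hQ hc1)
  have h₁ : Q₁ ∈ sphereCubes 𝒞 x r := ⟨hQ₁, _, subset_closure hy, hc1⟩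
  exact ⟨Q₁, h₁, Q₁, h₁, ⟨_, subset_closure hy, hc2⟩, SimpleGraph.Reachable.refl _⟩

/-- With the symmetric inclusion, neighbors with a common pole and radius have equal components, so
a choice depending on the component alone agrees for both. -/
lemma sphereComponent_subset (h : IsWhitney 𝒞 E) (hQ : Q ∈ 𝒞) (hQ' : Q' ∈ 𝒞)
    (hx : IsPole 𝒞 E Q x r) (hx' : IsPole 𝒞 E Q' x r) (hn : Q.Neighbor Q') :
    sphereComponent 𝒞 x r Q ⊆ sphereComponent 𝒞 x r Q' := by
  rintro R ⟨hR, Q₁, h₁, hm₁, hreach⟩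
  obtain ⟨-, -, Q₂, h₂, hm₂, -⟩ := hx'.sphereComponent_nonempty h hQ'
  exact ⟨hR, Q₂, h₂, hm₂, (hx.reachable h hQ hx' hn h₁ h₂ hm₁ hm₂).symm.trans hreach⟩

end IsPole

/-! ### Descent to the sphere and common targets of interstitial cubes -/

namespace IsWhitney

variable {𝒞 : Set (DyadicCube n)} {E : Finset (Fin n → ℝ)}

/-- Connected cubes of the sphere are joined by a bounded number of steps. -/
lemma exists_sphere_walk (n : ℕ) : ∃ D : ℕ, ∀ (𝒞 : Set (DyadicCube n)) (E : Finset (Fin n → ℝ)),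
    IsWhitney 𝒞 E → ∀ (Q : DyadicCube n) (x : Fin n → ℝ) (r : ℝ), IsPole 𝒞 E Q x r →
    ∀ a b : sphereCubes 𝒞 x r, (nbGraph (sphereCubes 𝒞 x r)).Reachable a b →
      ShortWalk 𝒞 D a b := by
  obtain ⟨D, hD⟩ := DyadicCube.exists_packing n 16
  refine ⟨D, fun 𝒞 E h Q x r hx a b hab => ?_⟩
  have hr := hx.pos
  obtain ⟨h1, h2⟩ := hD (sphereCubes 𝒞 x r \ {b.1}) (r / 8) x (by positivity) (by
    rintro R ⟨⟨hR, y, hy, hyr⟩, -⟩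
    have hyr : ‖y - x‖ = r := hyr
    have hle : ‖y - x‖ ≤ 4 * Q.side := by linarith [hx.le]
    have h1 := hx.side_bounds h hR hy hyr.ge hle
    have h2 := hx.center_bound h hR hy hyr.ge hle
    rw [hyr] at h1 h2
    refine ⟨h1.1, by linarith [h1.2], by linarith⟩)
  obtain ⟨Q'', ⟨-, hQ''⟩, hw⟩ := exists_shortWalk a b hab (Set.mem_singleton _) h1 h2
  rw [Set.mem_singleton_iff] at hQ''
  rw [← hQ'']
  exact hw.mono (fun R hR => hR.1) le_rfl

/-- From a cube one descends along the ray towards its pole to the sphere. -/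
lemma exists_radial_walk (n : ℕ) : ∃ B : ℕ, ∀ (𝒞 : Set (DyadicCube n)) (E : Finset (Fin n → ℝ)),
    IsWhitney 𝒞 E → ∀ Q ∈ 𝒞, ∀ (x : Fin n → ℝ) (r : ℝ), IsPole 𝒞 E Q x r →
    ∃ Q₁ ∈ 𝒞, ∃ Q₂ ∈ 𝒞, radialProj x r Q.center ∈ closure Q₂.toSet ∧
      Relation.ReflTransGen (HalfStep 𝒞 B) Q Q₁ ∧ ShortWalk 𝒞 B Q₁ Q₂ := by
  obtain ⟨D, hD⟩ := exists_walk_bound n 512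
  refine ⟨D, fun 𝒞 E h Q hQ x r hx => ?_⟩
  have hr := hx.pos
  have hQs := Q.side_pos
  have ht₀ : 0 < ‖Q.center - x‖ := by linarith [hx.far]
  let γ : ℝ → Fin n → ℝ := fun t => x + (t / ‖Q.center - x‖) • (Q.center - x)
  have hγ : ∀ t, 0 ≤ t → ‖γ t - x‖ = t := by
    intro t ht
    simp only [γ]
    rw [add_sub_cancel_left, norm_smul, Real.norm_of_nonneg (by positivity)]
    field_simp
  have hγunit : ∀ t, 0 ≤ t → t ≤ ‖Q.center - x‖ → γ t ∈ (DyadicCube.unit n).toSet := by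
    intro t ht ht'
    exact (DyadicCube.unit n).convex_toSet.add_smul_sub_mem
      (h.mem_unit_of_mem (r := 0) hx.mem (by norm_num) (by simp)) (h.center_mem hQ)
      ⟨by positivity, (div_le_one ht₀).2 ht'⟩
  have hγc : Continuous γ := by fun_prop
  have hwalk : ∀ t₁ t₂, r ≤ t₂ → t₂ ≤ t₁ → t₁ ≤ ‖Q.center - x‖ → t₁ ≤ 32 * t₂ →
      ∀ Q₁ ∈ 𝒞, ∀ Q₂ ∈ 𝒞, γ t₁ ∈ closure Q₁.toSet → γ t₂ ∈ closure Q₂.toSet →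
      ShortWalk 𝒞 D Q₁ Q₂ := by
    intro t₁ t₂ hr2 h21 h10 h32 Q₁ hQ₁ Q₂ hQ₂ hm₁ hm₂
    obtain ⟨Q'', -, hQ'', hw⟩ := hD 𝒞 E h (γ '' Set.Icc t₂ t₁)
      (isPreconnected_Icc.image _ hγc.continuousOn)
      (by rintro _ ⟨t, ht, rfl⟩; exact hγunit t (by linarith [ht.1]) (ht.2.trans h10))
      -- The cubes on the segment have sides between `t₂ / 8 ≥ t₁ / 256` and `2 * t₁ = 512 * (t₁ /
      -- 256)`.
      {Q₂} (t₁ / 256) x (by linarith) (by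
        rintro R ⟨hR, _, hy, t, ht, rfl⟩ -
        have hty := hγ t (by linarith [ht.1])
        have e1 : r ≤ ‖γ t - x‖ := by rw [hty]; exact hr2.trans ht.1
        have e2 : ‖γ t - x‖ ≤ 4 * Q.side := by
          rw [hty]; exact (ht.2.trans h10).trans hx.close
        have h1 := hx.side_bounds h hR hy e1 e2
        have h2 := hx.center_bound h hR hy e1 e2
        rw [hty] at h1 h2
        refine ⟨by linarith [h1.1, ht.1], by linarith [h1.2, ht.2], by linarith [ht.2]⟩)
      Q₁ ⟨hQ₁, _, hm₁, t₁, ⟨h21, le_rfl⟩, rfl⟩ Q₂ ⟨hQ₂, _, hm₂, t₂, ⟨le_rfl, h21⟩, rfl⟩ rfl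
    rw [Set.mem_singleton_iff] at hQ''
    rwa [hQ''] at hw
  have main : ∀ j : ℕ, ∀ t, r ≤ t → t ≤ ‖Q.center - x‖ → t ≤ 32 ^ j * (32 * r) → ∀ Q₀ ∈ 𝒞,
      γ t ∈ closure Q₀.toSet → ∃ Q₁ ∈ 𝒞, ∃ Q₂ ∈ 𝒞, γ r ∈ closure Q₂.toSet ∧
        Relation.ReflTransGen (HalfStep 𝒞 D) Q₀ Q₁ ∧ ShortWalk 𝒞 D Q₁ Q₂ := by
    have hdirect : ∀ t, r ≤ t → t ≤ ‖Q.center - x‖ → t ≤ 32 * r → ∀ Q₀ ∈ 𝒞,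
        γ t ∈ closure Q₀.toSet → ∃ Q₁ ∈ 𝒞, ∃ Q₂ ∈ 𝒞, γ r ∈ closure Q₂.toSet ∧
          Relation.ReflTransGen (HalfStep 𝒞 D) Q₀ Q₁ ∧ ShortWalk 𝒞 D Q₁ Q₂ := by
      intro t ht ht' ht32 Q₀ hQ₀ hm
      obtain ⟨Q₂, hQ₂, hm₂⟩ := h.cover (γ r) (hγunit r hr.le (ht.trans ht'))
      exact ⟨Q₀, hQ₀, Q₂, hQ₂, subset_closure hm₂, Relation.ReflTransGen.refl,
        hwalk t r le_rfl ht ht' ht32 Q₀ hQ₀ Q₂ hQ₂ hm (subset_closure hm₂)⟩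
    intro j
    induction j with
    | zero =>
      intro t ht ht' htj
      exact hdirect t ht ht' (by linarith)
    | succ j ih =>
      intro t ht ht' htj Q₀ hQ₀ hm
      rcases le_or_gt t (32 * r) with h32 | h32
      · exact hdirect t ht ht' h32 Q₀ hQ₀ hm
      -- Passing from radius `t` to `t / 32` lowers the side from at least `t / 8` to at most `t /
      -- 16`, which is a half step.
      · have ht2 : t / 32 ≤ ‖Q.center - x‖ := by linarith
        obtain ⟨Q₁, hQ₁, hm₁⟩ := h.cover (γ (t / 32)) (hγunit _ (by linarith) ht2)
        obtain ⟨Q₂, hQ₂, Q₃, hQ₃, hm₃, hp, hw⟩ := ih (t / 32) (by linarith) ht2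
          (by rw [pow_succ] at htj; linarith) Q₁ hQ₁ (subset_closure hm₁)
        have hg₀ := hγ t (by linarith)
        have hg₁ := hγ (t / 32) (by linarith)
        have hs₀ := (hx.side_bounds h hQ₀ hm (by rwa [hg₀]) (by linarith [hx.close])).1
        have hs₁ := (hx.side_bounds h hQ₁ (subset_closure hm₁) (by rw [hg₁]; linarith)
          (by linarith [hx.close])).2
        rw [hg₀] at hs₀
        rw [hg₁] at hs₁
        exact ⟨Q₂, hQ₂, Q₃, hQ₃, hm₃, hp.head ⟨hwalk t (t / 32) (by linarith) (by linarith) ht'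
          (by linarith) Q₀ hQ₀ Q₁ hQ₁ hm (subset_closure hm₁), by linarith⟩, hw⟩
  obtain ⟨j, hj⟩ := pow_unbounded_of_one_lt (‖Q.center - x‖ / (32 * r)) (by norm_num : (1 : ℝ) < 32)
  rw [div_lt_iff₀ (by positivity)] at hj
  refine main j ‖Q.center - x‖ ?_ le_rfl hj.le Q hQ (subset_closure ?_)
  · linarith [hx.far, hx.le]
  · have : γ ‖Q.center - x‖ = Q.center := by
      simp only [γ]
      rw [div_self ht₀.ne', one_smul, add_sub_cancel]
    rw [this]
    exact Q.center_mem

/-- The cluster seen by `Q` lies within about four sidelengths of its center; the radius `16` leaves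
room for a neighbor of half the size. -/
lemma nearPoints_eq (h : IsWhitney 𝒞 E) {Q Q' : DyadicCube n} (hQ : Q ∈ interstitial 𝒞 E)
    (hQ' : Q' ∈ interstitial 𝒞 E) (hn : Q.Neighbor Q') : nearPoints E Q = nearPoints E Q' := by
  have key : ∀ Q Q' : DyadicCube n, Q ∈ interstitial 𝒞 E → Q' ∈ interstitial 𝒞 E →
      Q.Neighbor Q' → nearPoints E Q ⊆ nearPoints E Q' := by
    intro Q Q' hQ hQ' hn e he
    rw [nearPoints, Finset.mem_filter] at he ⊢
    refine ⟨he.1, ?_⟩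
    have hs := Q.side_pos
    obtain ⟨x, hx, hxQ⟩ := h.near Q hQ.1
    have h1 := hQ.2.2 e he.1 x hx he.2 (by linarith)
    have h2 := hn.norm_le
    have h3 := h.balanced Q' hQ'.1 Q hQ.1 hn.symm
    calc ‖e - Q'.center‖ = ‖(e - x) + ((x - Q.center) + (Q.center - Q'.center))‖ := by
          congr 1; abel
      _ ≤ ‖e - x‖ + (‖x - Q.center‖ + ‖Q.center - Q'.center‖) :=
        (norm_add_le _ _).trans (by gcongr; exact norm_add_le _ _)
      _ ≤ _ := by linarith
  exact (key Q Q' hQ hQ' hn).antisymm (key Q' Q hQ' hQ hn.symm)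

/-- Poles of interstitial cubes can be chosen in dependence on the nearby points only. -/
lemma exists_pole (h : IsWhitney 𝒞 E) :
    ∃ (X : Finset (Fin n → ℝ) → Fin n → ℝ) (r : Finset (Fin n → ℝ) → ℝ),
      ∀ Q ∈ interstitial 𝒞 E, IsPole 𝒞 E Q (X (nearPoints E Q)) (r (nearPoints E Q)) := by
  have hcube : ∀ x : Fin n → ℝ, ∃ R : DyadicCube n, x ∈ E → R ∈ 𝒞 ∧ x ∈ R.toSet := by
    intro x
    by_cases hx : x ∈ E
    · obtain ⟨R, hR⟩ := h.exists_mem_cube hx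
      exact ⟨R, fun _ => hR⟩
    · exact ⟨DyadicCube.unit n, fun h => absurd h hx⟩
  choose R hR using hcube
  have hsel : ∀ H : Finset (Fin n → ℝ), ∃ x e₀ : Fin n → ℝ, H.Nonempty →
      x ∈ H ∧ e₀ ∈ H ∧ ∀ e ∈ H, ‖e - x‖ ≤ ‖e₀ - x‖ := by
    intro H
    by_cases hH : H.Nonempty
    · obtain ⟨x, hx⟩ := hH
      obtain ⟨e₀, he₀, hmax⟩ := H.exists_max_image (fun e => ‖e - x‖) ⟨x, hx⟩
      exact ⟨x, e₀, fun _ => ⟨hx, he₀, hmax⟩⟩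
    · exact ⟨0, 0, fun h => absurd h hH⟩
  choose X e₀ hX using hsel
  -- The radius clears both the cluster and the cube containing its pole; the latter also makes it
  -- positive when the cluster is a single point.
  refine ⟨X, fun H => max (2 * ‖e₀ H - X H‖) (4 * (R (X H)).side), fun Q hQ => ?_⟩
  have hs := Q.side_pos
  obtain ⟨y, hy, hyQ⟩ := h.near Q hQ.1
  have hyH : y ∈ nearPoints E Q := Finset.mem_filter.2 ⟨hy, by linarith⟩
  obtain ⟨h1, h2, h3⟩ := hX (nearPoints E Q) ⟨y, hyH⟩
  set x := X (nearPoints E Q)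
  set e := e₀ (nearPoints E Q)
  have hx := Finset.mem_filter.1 h1
  have he := Finset.mem_filter.1 h2
  have hxy := hQ.2.2 x hx.1 y hy hx.2 (by linarith)
  have hex := hQ.2.2 e he.1 x hx.1 he.2 hx.2
  have hclose : ‖x - Q.center‖ ≤ 4 * Q.side :=
    calc ‖x - Q.center‖ = ‖(x - y) + (y - Q.center)‖ := by congr 1; abel
      _ ≤ _ := norm_add_le _ _
      _ ≤ _ := by linarith
  obtain ⟨R', hR', hxR', hR's⟩ := hQ.2.1 x hx.1 hclose
  obtain ⟨hRx, hxR⟩ := hR x hx.1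
  have hRs : (R x).side ≤ 2 * R'.side :=
    h.balanced R' hR' (R x) hRx ⟨x, subset_closure hxR', subset_closure hxR⟩
  have hRpos := (R x).side_pos
  refine ⟨hx.1, lt_max_of_lt_right (by positivity), max_le (by linarith) (by linarith),
    by rwa [norm_sub_rev], ?_, ⟨R x, hRx, hxR, le_max_right _ _⟩, fun z hz hzQ =>
      le_max_of_le_left (by linarith [h3 z (Finset.mem_filter.2 ⟨hz, hzQ⟩)])⟩
  have h4 := h.slow (R x) hRx Q hQ.1
  have h5 := DyadicCube.norm_sub_center_le_of_mem hxR
  have h6 : ‖(R x).center - Q.center‖ ≤ ‖Q.center - x‖ + (R x).side / 2 := by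
    rw [norm_sub_rev]
    calc ‖Q.center - (R x).center‖ = ‖(Q.center - x) + (x - (R x).center)‖ := by congr 1; abel
      _ ≤ _ := norm_add_le _ _
      _ ≤ _ := by linarith
  linarith

/-- To the interstitial cubes one can assign targets, the same one to neighbors, that are reached
along chains of geometrically decreasing cubes. -/
lemma exists_target (n : ℕ) : ∃ B : ℕ, ∀ (𝒞 : Set (DyadicCube n)) (E : Finset (Fin n → ℝ)),
    IsWhitney 𝒞 E → ∃ τ : DyadicCube n → DyadicCube n,
      (∀ Q ∈ interstitial 𝒞 E, τ Q ∈ 𝒞 ∧ ∃ Q₁ ∈ 𝒞,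
        Relation.ReflTransGen (HalfStep 𝒞 B) Q Q₁ ∧ ∃ Q₂ ∈ 𝒞,
        ShortWalk 𝒞 B Q₁ Q₂ ∧ ShortWalk 𝒞 B Q₂ (τ Q)) ∧
      ∀ Q ∈ interstitial 𝒞 E, ∀ Q' ∈ interstitial 𝒞 E, Q.Neighbor Q' → τ Q = τ Q' := by
  classical
  obtain ⟨B₁, hB₁⟩ := exists_radial_walk n
  obtain ⟨B₂, hB₂⟩ := exists_sphere_walk n
  refine ⟨max B₁ B₂, fun 𝒞 E h => ?_⟩
  obtain ⟨X, r, hX⟩ := h.exists_pole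
  -- The choice is a function of the set alone, so equal components yield equal targets.
  let pick : Set (DyadicCube n) → DyadicCube n := fun S =>
    if hS : S.Nonempty then hS.some else DyadicCube.unit n
  have hpick : ∀ S : Set (DyadicCube n), S.Nonempty → pick S ∈ S := by
    intro S hS
    simp only [pick, dif_pos hS]
    exact hS.some_mem
  refine ⟨fun Q => pick (sphereComponent 𝒞 (X (nearPoints E Q)) (r (nearPoints E Q)) Q),
    fun Q hQ => ?_, fun Q hQ Q' hQ' hn => ?_⟩
  · have hx := hX Q hQ
    obtain ⟨hτ, Q₁, h₁, hm₁, hreach⟩ := hpick _ (hx.sphereComponent_nonempty h hQ.1)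
    obtain ⟨Q₂, hQ₂, Q₃, hQ₃, hm₃, hp, hw⟩ := hB₁ 𝒞 E h Q hQ.1 _ _ hx
    have h₃ : Q₃ ∈ sphereCubes 𝒞 (X (nearPoints E Q)) (r (nearPoints E Q)) :=
      ⟨hQ₃, _, hm₃, hx.radialProj_center_mem.1⟩
    have hself : Q.Neighbor Q :=
      ⟨Q.center, subset_closure Q.center_mem, subset_closure Q.center_mem⟩
    have hr := hx.reachable h hQ.1 hx hself h₃ h₁ ⟨_, hm₃, hx.radialProj_center_mem.2⟩ hm₁
    exact ⟨hτ.1, Q₂, hQ₂, reflTransGen_halfStep_mono (le_max_left _ _) hp,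
      Q₃, hQ₃, hw.mono subset_rfl (le_max_left _ _),
      (hB₂ 𝒞 E h Q _ _ hx _ _ (hr.trans hreach)).mono subset_rfl (le_max_right _ _)⟩
  · have hx := hX Q hQ
    have hx' := hX Q' hQ'
    rw [← h.nearPoints_eq hQ hQ' hn] at hx'
    simp only
    rw [← h.nearPoints_eq hQ hQ' hn]
    congr 1
    exact (hx.sphereComponent_subset h hQ.1 hQ'.1 hx' hn).antisymm
      (hx'.sphereComponent_subset h hQ'.1 hQ.1 hx hn.symm)

end IsWhitney

/-! ### Assignment of keystone cubes and the count of disagreeing neighbors -/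

namespace IsWhitney

variable {𝒞 : Set (DyadicCube n)} {E : Finset (Fin n → ℝ)}

/-- A point of `E` within `7 / 2` sidelengths lies in a much smaller cube, which therefore meets
`100 Q`. Hence rerouting interstitial cubes leaves (K3) intact. -/
lemma notMem_keystone_of_interstitial (h : IsWhitney 𝒞 E) {Q : DyadicCube n}
    (hQ : Q ∈ interstitial 𝒞 E) : Q ∉ keystone 𝒞 := by
  intro hkey
  have hs := Q.side_pos
  obtain ⟨x, hx, hxQ⟩ := h.near Q hQ.1
  obtain ⟨R, hR, hxR, hlt⟩ := hQ.2.1 x hx (by linarith)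
  have := hkey.2 R hR ⟨x, hxR, DyadicCube.mem_dilate_of_norm_lt (by linarith)⟩
  linarith

/-- The number of the pairs of neighbors that are not both interstitial is bounded by a multiple
of the number of the points of `E`. -/
lemma exists_card_pairs (n : ℕ) : ∃ D : ℕ, ∀ (𝒞 : Set (DyadicCube n)) (E : Finset (Fin n → ℝ)),
    IsWhitney 𝒞 E →
    {q : DyadicCube n × DyadicCube n | q.1 ∈ 𝒞 ∧ q.2 ∈ 𝒞 ∧ q.1.Neighbor q.2 ∧
      (q.1 ∉ interstitial 𝒞 E ∨ q.2 ∉ interstitial 𝒞 E)}.ncard ≤ D * E.card := by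
  classical
  obtain ⟨D₁, hD₁⟩ := exists_degree_bound n
  obtain ⟨D₂, hD₂⟩ := exists_card_exceptional n
  refine ⟨2 * (D₁ * D₂), fun 𝒞 E h => ?_⟩
  have hXfin : (𝒞 \ interstitial 𝒞 E).Finite := h.finite.subset Set.sdiff_subset
  let X : Finset (DyadicCube n) := hXfin.toFinset
  have hX : X.card ≤ D₂ * E.card := by
    rw [← Set.ncard_eq_toFinset_card _ hXfin]
    exact hD₂ 𝒞 E h
  let N : DyadicCube n → Set (DyadicCube n) := fun Q => {Q' ∈ 𝒞 | Q.Neighbor Q'}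
  have hN : ∀ Q, (N Q).Finite := fun Q => h.finite.subset fun _ hR => hR.1
  let P : Set (DyadicCube n × DyadicCube n) := ⋃ Q ∈ X, Prod.mk Q '' N Q
  have hPfin : P.Finite := Set.Finite.biUnion X.finite_toSet fun Q _ => (hN Q).image _
  have hP : P.ncard ≤ D₁ * D₂ * E.card :=
    calc P.ncard ≤ ∑ Q ∈ X, (Prod.mk Q '' N Q).ncard := Finset.set_ncard_biUnion_le X _
      _ ≤ ∑ Q ∈ X, D₁ := Finset.sum_le_sum fun Q hQ =>
        (Set.ncard_image_le (hN Q)).trans (hD₁ 𝒞 E h Q (by simp [X] at hQ; exact hQ.1))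
      _ = D₁ * X.card := by rw [Finset.sum_const, smul_eq_mul, mul_comm]
      _ ≤ D₁ * (D₂ * E.card) := by gcongr
      _ = _ := by ring
  have hmem : ∀ Q ∈ 𝒞, ∀ Q' ∈ 𝒞, Q.Neighbor Q' → Q ∉ interstitial 𝒞 E → (Q, Q') ∈ P :=
    fun Q hQ Q' hQ' hn hni => Set.mem_biUnion (by simp [X]; exact ⟨hQ, hni⟩) ⟨Q', ⟨hQ', hn⟩, rfl⟩
  have hsub : {q : DyadicCube n × DyadicCube n | q.1 ∈ 𝒞 ∧ q.2 ∈ 𝒞 ∧ q.1.Neighbor q.2 ∧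
      (q.1 ∉ interstitial 𝒞 E ∨ q.2 ∉ interstitial 𝒞 E)} ⊆ P ∪ Prod.swap '' P := by
    rintro ⟨Q, Q'⟩ ⟨hQ, hQ', hn, hni | hni⟩
    · exact Or.inl (hmem Q hQ Q' hQ' hn hni)
    · exact Or.inr ⟨(Q', Q), hmem Q' hQ' Q hQ hn.symm hni, rfl⟩
  calc _ ≤ (P ∪ Prod.swap '' P).ncard := Set.ncard_le_ncard hsub (hPfin.union (hPfin.image _))
    _ ≤ P.ncard + (Prod.swap '' P).ncard := Set.ncard_union_le _ _
    _ ≤ P.ncard + P.ncard := Nat.add_le_add_left (Set.ncard_image_le hPfin) _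
    _ ≤ _ := by linarith

/-- Keystone cubes can be assigned to the cubes of the decomposition in such a way that each cube is
joined to its keystone cube by a chain of geometrically decreasing cubes, and that few neighbors
have different keystone cubes. -/
lemma exists_assignment (n : ℕ) : ∃ (M θ : ℝ) (D : ℕ), 0 < M ∧ 0 < θ ∧ θ < 1 ∧
    ∀ (𝒞 : Set (DyadicCube n)) (E : Finset (Fin n → ℝ)), IsWhitney 𝒞 E →
    ∃ K : DyadicCube n → DyadicCube n,
      (∀ Q ∈ 𝒞, K Q ∈ keystone 𝒞 ∧ DecayPath 𝒞 M θ Q (K Q)) ∧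
      {q : DyadicCube n × DyadicCube n | q.1 ∈ 𝒞 ∧ q.2 ∈ 𝒞 ∧ q.1.Neighbor q.2 ∧
        K q.1 ≠ K q.2}.ncard ≤ D * E.card ∧
      ∀ Q ∈ keystone 𝒞, K Q = Q := by
  classical
  obtain ⟨B₁, hB₁⟩ := exists_keystone n
  obtain ⟨B₂, hB₂⟩ := exists_target n
  obtain ⟨D, hD⟩ := exists_card_pairs n
  let B := max 1 (max B₁ B₂)
  have hB : 1 ≤ B := le_max_left _ _
  have hBB₁ : B₁ ≤ B := (le_max_left _ _).trans (le_max_right _ _)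
  have hBB₂ : B₂ ≤ B := (le_max_right _ _).trans (le_max_right _ _)
  obtain ⟨hθ, hθ1, -⟩ := rate_bounds hB
  have hθ0 : 0 < rate B := by linarith
  let a : ℝ := 2 ^ (2 * B + 1)
  let b : ℝ := 2 ^ (B + 1)
  have ha : 1 ≤ a := one_le_pow₀ (by norm_num)
  have hb : 1 ≤ b := one_le_pow₀ (by norm_num)
  have hbb : 1 ≤ b * b := one_le_mul_of_one_le_of_one_le hb hb
  have hbba : 1 ≤ b * b * a := one_le_mul_of_one_le_of_one_le hbb ha
  refine ⟨a * (b * b * a), rate B, D, by positivity, hθ0, hθ1, fun 𝒞 E h => ?_⟩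
  have hbal := h.balanced
  have hgen : ∀ Q : DyadicCube n, ∃ K, Q ∈ 𝒞 → K ∈ keystone 𝒞 ∧ DecayPath 𝒞 a (rate B) Q K ∧
      (Q ∈ keystone 𝒞 → K = Q) := by
    intro Q
    by_cases hQ : Q ∈ 𝒞
    · obtain ⟨K, hK, hp, hKQ⟩ := hB₁ 𝒞 E h Q hQ
      exact ⟨K, fun _ => ⟨hK, decayPath_of_halfSteps hbal hB hK.1
        (reflTransGen_halfStep_mono hBB₁ hp), hKQ⟩⟩
    · exact ⟨Q, fun h => absurd h hQ⟩
  choose g hg using hgen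
  obtain ⟨τ, hτ, hττ⟩ := hB₂ 𝒞 E h
  -- The target may itself be interstitial; it is followed by the unmodified assignment `g`, so
  -- there is no recursion.
  refine ⟨fun Q => if Q ∈ interstitial 𝒞 E then g (τ Q) else g Q, fun Q hQ => ?_, ?_, ?_⟩
  · beta_reduce
    split_ifs with hI
    · obtain ⟨hτQ, Q₁, hQ₁, hp, Q₂, hQ₂, hw₁, hw₂⟩ := hτ Q hI
      obtain ⟨hK, hd, -⟩ := hg _ hτQ
      refine ⟨hK, ?_⟩
      have d₁ := decayPath_of_halfSteps hbal hB hQ₁ (reflTransGen_halfStep_mono hBB₂ hp)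
      have d₂ := (hw₁.mono subset_rfl hBB₂).decayPath hbal hB
      have d₃ := (hw₂.mono subset_rfl hBB₂).decayPath hbal hB
      exact d₁.trans hθ0.le ha hbba ((d₂.trans hθ0.le hb hb d₃).trans hθ0.le hbb ha hd)
    · obtain ⟨hK, hd, -⟩ := hg Q hQ
      exact ⟨hK, hd.mono hθ0.le (le_mul_of_one_le_right (by positivity) hbba)⟩
  · refine (Set.ncard_le_ncard ?_ ?_).trans (hD 𝒞 E h)
    · rintro ⟨Q, Q'⟩ ⟨hQ, hQ', hn, hne⟩
      refine ⟨hQ, hQ', hn, ?_⟩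
      by_contra hcon
      push Not at hcon
      refine hne ?_
      simp only [if_pos hcon.1, if_pos hcon.2]
      rw [hττ Q hcon.1 Q' hcon.2 hn]
    · exact (h.finite.prod h.finite).subset fun q hq => ⟨hq.1, hq.2.1⟩
  · intro Q hQ
    beta_reduce
    rw [if_neg fun hI => h.notMem_keystone_of_interstitial hI hQ]
    exact (hg Q hQ.1).2.2 hQ

end IsWhitney

/-- The assignment of keystone cubes, with the chains as sequences of members of the family. -/
theorem exists_keystone_sequences (n : ℕ) : ∃ C c : ℝ, 0 < C ∧ 0 < c ∧ c < 1 ∧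
    ∀ (𝒞 : Set (DyadicCube n)) (E : Finset (Fin n → ℝ)), IsWhitney 𝒞 E →
      ∃ (L : 𝒞 → ℕ) (S : 𝒞 → ℕ → 𝒞),
        (∀ Q : 𝒞, 1 ≤ L Q ∧ S Q 1 = Q ∧ (S Q (L Q)).1 ∈ keystone 𝒞 ∧
          (∀ l, 1 ≤ l → l < L Q → (S Q l).1.Neighbor (S Q (l + 1)).1) ∧
          (∀ l k, 1 ≤ l → l ≤ k → k ≤ L Q →
            (S Q k).1.side ≤ C * (1 - c) ^ (k - l) * (S Q l).1.side)) ∧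
        (({q : 𝒞 × 𝒞 | q.1.1.Neighbor q.2.1 ∧ S q.1 (L q.1) ≠ S q.2 (L q.2)}.ncard : ℝ) ≤
          C * (E.card : ℝ)) ∧
        (∀ Q : 𝒞, Q.1 ∈ keystone 𝒞 → S Q (L Q) = Q) := by
  classical
  obtain ⟨M, θ, D, hM, hθ, hθ1, H⟩ := IsWhitney.exists_assignment n
  refine ⟨M + D, 1 - θ, by positivity, by linarith, by linarith, fun 𝒞 E h => ?_⟩
  obtain ⟨K, hK, hpairs, hKK⟩ := H 𝒞 E h
  have hpath : ∀ Q : 𝒞, DecayPath 𝒞 M θ Q (K Q) := fun Q => (hK Q Q.2).2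
  choose L f f0 fL f2 f3 f4 using hpath
  -- The sequences are indexed from one, hence the shift; values beyond the end are irrelevant.
  let S : 𝒞 → ℕ → 𝒞 := fun Q i => if hi : i ≤ L Q + 1 then ⟨f Q (i - 1), f2 Q _ (by omega)⟩ else Q
  have hS : ∀ Q i, i ≤ L Q + 1 → (S Q i).1 = f Q (i - 1) := fun Q i hi => by
    simp only [S, dif_pos hi]
  have hSL : ∀ Q, (S Q (L Q + 1)).1 = K Q := fun Q => by
    rw [hS Q _ le_rfl, Nat.add_sub_cancel, fL]
  refine ⟨fun Q => L Q + 1, S, fun Q => ⟨Nat.le_add_left 1 _, ?_, ?_, ?_, ?_⟩, ?_, fun Q hQ => ?_⟩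
  · exact Subtype.ext (by rw [hS Q 1 (by omega), Nat.sub_self, f0])
  · rw [hSL]; exact (hK Q Q.2).1
  · intro l hl hlL
    beta_reduce at hlL
    rw [hS Q l (by omega), hS Q (l + 1) (by omega), show l + 1 - 1 = l - 1 + 1 by omega]
    exact f3 Q _ (by omega)
  · intro l k hl hlk hk
    beta_reduce at hk
    rw [hS Q l (by omega), hS Q k (by omega)]
    have := f4 Q (l - 1) (k - 1) (by omega) (by omega)
    rw [show k - 1 - (l - 1) = k - l by omega] at this
    refine this.trans ?_
    have hs := (f Q (l - 1)).side_pos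
    rw [sub_sub_cancel]
    gcongr
    linarith [(Nat.cast_nonneg D : (0 : ℝ) ≤ D)]
  · have hle : {q : 𝒞 × 𝒞 | q.1.1.Neighbor q.2.1 ∧ S q.1 (L q.1 + 1) ≠ S q.2 (L q.2 + 1)}.ncard ≤
        D * E.card := by
      refine (Set.ncard_le_ncard_of_injOn (Prod.map Subtype.val Subtype.val) ?_
        (Function.Injective.injOn (Subtype.val_injective.prodMap Subtype.val_injective))
        ((h.finite.prod h.finite).subset fun q hq => ⟨hq.1, hq.2.1⟩)).trans hpairs
      rintro ⟨Q, Q'⟩ ⟨hn, hne⟩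
      refine ⟨Q.2, Q'.2, hn, fun heq => hne (Subtype.ext ?_)⟩
      rw [hSL, hSL]
      exact heq
    calc _ ≤ ((D * E.card : ℕ) : ℝ) := by exact_mod_cast hle
      _ = D * (E.card : ℝ) := by push_cast; ring
      _ ≤ _ := by gcongr; linarith
  · exact Subtype.ext (by rw [hSL, hKK Q hQ])

/-! ### Scaling of jets and of the Sobolev seminorm -/

lemma pd_const_smul (i : Fin n) (c : ℝ) (f : (Fin n → ℝ) → ℝ) : pd i (c • f) = c • pd i f := by
  funext x
  simp only [pd, Pi.smul_apply]
  rw [fderiv_const_smul_field]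
  rfl

lemma pderivs_const_smul (α : Fin n → ℕ) (c : ℝ) (f : (Fin n → ℝ) → ℝ) :
    pderivs α (c • f) = c • pderivs α f := by
  have hit : ∀ (i : Fin n) (k : ℕ) (g : (Fin n → ℝ) → ℝ),
      (pd i)^[k] (c • g) = c • (pd i)^[k] g := by
    intro i k g
    induction k generalizing g with
    | zero => rfl
    | succ k ih => rw [Function.iterate_succ_apply, pd_const_smul, ih, ← Function.iterate_succ_apply]
  unfold pderivs
  induction List.finRange n with
  | nil => rfl
  | cons i l ih => rw [List.foldr_cons, List.foldr_cons, ih, hit]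

lemma jet_const_smul (m : ℕ) (c : ℝ) (F : (Fin n → ℝ) → ℝ) (y : Fin n → ℝ) :
    jet m (c • F) y = c • jet m F y := by
  simp only [jet, Finset.smul_sum]
  refine Finset.sum_congr rfl fun α _ => ?_
  rw [pderivs_const_smul, Pi.smul_apply, smul_eq_mul, mul_div_assoc, MvPolynomial.C_mul,
    MvPolynomial.smul_eq_C_mul, mul_assoc]

lemma HasWeakDeriv.const_smul {α : Fin n → ℕ} {F g : (Fin n → ℝ) → ℝ} (h : HasWeakDeriv α F g)
    (c : ℝ) : HasWeakDeriv α (c • F) (c • g) := by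
  obtain ⟨h1, h2, h3⟩ := h
  refine ⟨h1.smul c, h2.smul c, fun θ hθ hθ' => ?_⟩
  have := h3 θ hθ hθ'
  simp only [Pi.smul_apply, smul_eq_mul, mul_assoc]
  rw [integral_const_mul, integral_const_mul, this]
  ring

lemma sobolevSeminorm_const_smul_le (m : ℕ) (p : ℝ) {c : ℝ} (hc : |c| ≤ 1)
    (F : (Fin n → ℝ) → ℝ) : sobolevSeminorm m p (c • F) ≤ sobolevSeminorm m p F := by
  refine iSup₂_mono fun α _ => le_iInf₂ fun g hg => iInf₂_le_of_le (c • g) (hg.const_smul c) ?_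
  refine eLpNorm_const_smul_le.trans ?_
  have : ‖c‖ₑ ≤ 1 := by
    rw [← ofReal_norm, Real.norm_eq_abs]
    exact ENNReal.ofReal_le_one.2 hc
  calc ‖c‖ₑ * _ ≤ 1 * _ := by gcongr
    _ = _ := one_mul _

lemma smul_mem_sigma {m : ℕ} {p : ℝ} {x : Fin n → ℝ} {E : Set (Fin n → ℝ)}
    {P : MvPolynomial (Fin n) ℝ} (hP : P ∈ sigma m p x E) {c : ℝ} (hc : |c| ≤ 1) :
    c • P ∈ sigma m p x E := by
  obtain ⟨φ, ⟨h1, h2⟩, h3, h4, h5⟩ := hP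
  have hs := sobolevSeminorm_const_smul_le m p hc φ
  exact ⟨c • φ, ⟨h1.const_smul c, hs.trans_lt h2⟩, by rw [jet_const_smul, h3],
    fun y hy => by rw [Pi.smul_apply, h4 y hy, smul_zero], hs.trans h5⟩

lemma sigma_anti {m : ℕ} {p : ℝ} {x : Fin n → ℝ} {E E' : Set (Fin n → ℝ)} (h : E ⊆ E') :
    sigma m p x E' ⊆ sigma m p x E := by
  rintro P ⟨φ, h1, h2, h3, h4⟩
  exact ⟨φ, h1, h2, fun y hy => h3 y (h hy), h4⟩

/-- The order of a multi-index is its `n`-th partial sum, the first one that the comparison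
examines. -/
lemma miOrder_le_of_lt {α β : Fin n → ℕ} (h : MultiIndexLT α β) : miOrder α ≤ miOrder β := by
  have hn : ∀ γ : Fin n → ℕ, partialSum γ n = miOrder γ := by
    intro γ
    unfold partialSum miOrder
    congr 1
    ext i
    simp
  obtain ⟨k, hk, heq, hlt⟩ := h
  rw [← hn α, ← hn β]
  rcases hk.lt_or_eq with h | rfl
  · exact (heq n h le_rfl).le
  · exact hlt.le

/-- A basis is also a basis at a smaller scale for a smaller set of points. -/
lemma ContainsBasis.mono {m : ℕ} {p : ℝ} (hp : (n : ℝ) < p) {𝒜 : Finset (Fin n → ℕ)}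
    (h𝒜 : 𝒜 ⊆ multiIndices n m) {x : Fin n → ℝ} {ε δ δ' : ℝ} (hε : 0 < ε) (hδ : 0 < δ)
    (hδδ' : δ ≤ δ') {E E' : Set (Fin n → ℝ)} (hE : E ⊆ E')
    (h : ContainsBasis m p 𝒜 x ε δ' (sigma m p x E')) :
    ContainsBasis m p 𝒜 x ε δ (sigma m p x E) := by
  obtain ⟨P, h1, h2, h3⟩ := h
  have hδ' : 0 < δ' := hδ.trans_le hδδ'
  refine ⟨P, fun α hα => ?_, h2, fun α hα β hβ hlt => (h3 α hα β hβ hlt).trans ?_⟩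
  -- A nonpositive exponent makes the factor in front of `σ` increase as the scale decreases, and
  -- `σ` is stable under scalars of modulus at most one.
  · have he : (n : ℝ) / p + (miOrder α : ℝ) - (m : ℝ) ≤ 0 := by
      have hα' : miOrder α + 1 ≤ m := (Finset.mem_filter.1 (h𝒜 hα)).2
      have : ((miOrder α : ℝ) + 1) ≤ m := by exact_mod_cast hα'
      have hnp : (n : ℝ) / p ≤ 1 :=
        div_le_one_of_le₀ hp.le ((Nat.cast_nonneg n).trans hp.le)
      linarith
    obtain ⟨R, hR, hRP⟩ := h1 α hα
    set a' := ε * δ' ^ ((n : ℝ) / p + (miOrder α : ℝ) - (m : ℝ))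
    set a := ε * δ ^ ((n : ℝ) / p + (miOrder α : ℝ) - (m : ℝ))
    have ha' : 0 < a' := by positivity
    have ha : 0 < a := by positivity
    have haa : a' ≤ a := by
      have := Real.rpow_le_rpow_of_nonpos hδ hδδ' he
      simp only [a, a']
      gcongr
    refine ⟨(a' / a) • R, smul_mem_sigma (sigma_anti hE hR) ?_, ?_⟩
    · rw [abs_of_pos (by positivity)]
      exact (div_le_one ha).2 haa
    · simp only [smul_smul]
      rw [mul_div_cancel₀ _ ha.ne']
      exact hRP
  · have := Real.rpow_le_rpow_of_nonpos hδ hδδ'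
      (show (miOrder α : ℝ) - (miOrder β : ℝ) ≤ 0 by
        have : (miOrder α : ℝ) ≤ miOrder β := by exact_mod_cast miOrder_le_of_lt hlt
        linarith)
    gcongr

/-! ### Subcubes and parents -/

namespace DyadicCube

lemma toSet_subset_iff {Q Q' : DyadicCube n} : Q.toSet ⊆ Q'.toSet ↔
    ∀ i, Q'.center i - Q'.side / 2 ≤ Q.center i - Q.side / 2 ∧
      Q.center i + Q.side / 2 ≤ Q'.center i + Q'.side / 2 := by
  have hs := Q.side_pos
  constructor
  · intro h i
    constructor
    · by_contra hlt
      rw [not_le] at hlt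
      -- A point of `Q` close enough to the open lower corner to violate the lower bound of `Q'` in
      -- coordinate `i`.
      have hx : (fun j => Q.center j - Q.side / 2 +
          min Q.side (Q'.center i - Q'.side / 2 - (Q.center i - Q.side / 2))) ∈ Q.toSet := by
        rw [mem_toSet_iff]
        intro j
        constructor
        · have : 0 < min Q.side (Q'.center i - Q'.side / 2 - (Q.center i - Q.side / 2)) :=
            lt_min hs (by linarith)
          linarith
        · linarith [min_le_left Q.side (Q'.center i - Q'.side / 2 - (Q.center i - Q.side / 2))]
      have := (mem_toSet_iff.1 (h hx) i).1
      linarith [min_le_right Q.side (Q'.center i - Q'.side / 2 - (Q.center i - Q.side / 2))]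
    · have hx : (fun j => Q.center j + Q.side / 2) ∈ Q.toSet := by
        rw [mem_toSet_iff]
        intro j
        constructor <;> linarith
      exact (mem_toSet_iff.1 (h hx) i).2
  · intro h x hx
    rw [mem_toSet_iff] at hx ⊢
    intro i
    exact ⟨(h i).1.trans_lt (hx i).1, (hx i).2.trans (h i).2⟩

lemma side_le_of_subset (hn : 1 ≤ n) {Q Q' : DyadicCube n} (h : Q.toSet ⊆ Q'.toSet) :
    Q.side ≤ Q'.side := by
  have := toSet_subset_iff.1 h ⟨0, hn⟩
  linarith [this.1, this.2]

lemma dilate_three_subset {Q Q' : DyadicCube n}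
    (h : ‖Q.center - Q'.center‖ + 3 * Q.side / 2 ≤ 3 * Q'.side / 2) :
    Q.dilate 3 ⊆ Q'.dilate 3 := by
  intro x hx i
  have := norm_le_pi_norm (Q.center - Q'.center) i
  rw [Real.norm_eq_abs, Pi.sub_apply] at this
  have h1 := abs_le.1 this
  constructor <;> linarith [(hx i).1, (hx i).2, h1.1, h1.2]

/-- The dyadic parent. -/
def parent (Q : DyadicCube n) : DyadicCube n := ⟨Q.k + 1, fun i => Q.j i / 2⟩

lemma parent_side (Q : DyadicCube n) : Q.parent.side = 2 * Q.side := by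
  simp only [side, parent]
  rw [zpow_add₀ (by norm_num), zpow_one, mul_comm]

lemma abs_parent_center_sub (Q : DyadicCube n) (i : Fin n) :
    |Q.parent.center i - Q.center i| ≤ Q.side / 2 := by
  have hs := Q.side_pos
  have hc : Q.parent.center i = (2 * ((Q.j i / 2 : ℤ) : ℝ) + 1) * Q.side := by
    have := Q.parent_side
    simp only [side] at this
    simp only [center, side]
    rw [this]
    simp only [parent]
    ring
  have hc' : Q.center i = ((Q.j i : ℝ) + 1 / 2) * Q.side := rfl
  have h1 : (2 * ((Q.j i / 2 : ℤ) : ℝ)) ≤ Q.j i := by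
    exact_mod_cast (by omega : 2 * (Q.j i / 2) ≤ Q.j i)
  have h2 : (Q.j i : ℝ) ≤ 2 * ((Q.j i / 2 : ℤ) : ℝ) + 1 := by
    exact_mod_cast (by omega : Q.j i ≤ 2 * (Q.j i / 2) + 1)
  rw [hc, hc', abs_le]
  constructor <;> nlinarith

lemma norm_parent_center_sub_le (Q : DyadicCube n) :
    ‖Q.parent.center - Q.center‖ ≤ Q.side / 2 := by
  rw [pi_norm_le_iff_of_nonneg (by linarith [Q.side_pos])]
  exact Q.abs_parent_center_sub

lemma toSet_ssubset_parent (hn : 1 ≤ n) (Q : DyadicCube n) : Q.toSet ⊂ Q.parent.toSet := by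
  refine ⟨toSet_subset_iff.2 fun i => ?_, fun h => ?_⟩
  · have := abs_le.1 (Q.abs_parent_center_sub i)
    rw [parent_side]
    constructor <;> linarith [this.1, this.2]
  · have := side_le_of_subset hn h
    rw [parent_side] at this
    linarith [Q.side_pos]

lemma side_eq_zpow_neg (Q : DyadicCube n) {K : ℕ} (hK : Q.k = -K) : Q.side * 2 ^ K = 1 := by
  rw [side, hK, zpow_neg, zpow_natCast, inv_mul_cancel₀ (by positivity)]

/-- A dyadic cube of sidelength `2 ^ (-K)` lies in the unit cube if and only if its position is
within the obvious bounds. -/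
lemma subset_unit_iff {Q : DyadicCube n} {K : ℕ} (hK : Q.k = -K) :
    Q.toSet ⊆ (unit n).toSet ↔ ∀ i, 0 ≤ Q.j i ∧ Q.j i + 1 ≤ 2 ^ K := by
  rw [toSet_subset_iff]
  refine forall_congr' fun i => ?_
  have hs := Q.side_pos
  have hK' := Q.side_eq_zpow_neg hK
  have hc : Q.center i = ((Q.j i : ℝ) + 1 / 2) * Q.side := rfl
  have hu : (unit n).center i = 1 / 2 := by simp [center, unit]
  have hus : (unit n).side = 1 := by simp [side, unit]
  rw [hu, hus, hc]
  have h1 : (0 ≤ Q.j i) ↔ (0 : ℝ) ≤ Q.j i * Q.side := by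
    rw [mul_nonneg_iff_of_pos_right hs]; exact_mod_cast Iff.rfl
  have h2 : (Q.j i + 1 ≤ 2 ^ K) ↔ ((Q.j i : ℝ) + 1) * Q.side ≤ 1 := by
    have h : ((Q.j i : ℝ) + 1) * Q.side ≤ 2 ^ K * Q.side ↔ (Q.j i : ℝ) + 1 ≤ 2 ^ K :=
      mul_le_mul_iff_of_pos_right hs
    rw [mul_comm (2 ^ K), hK'] at h
    rw [h]
    exact_mod_cast Iff.rfl
  rw [h1, h2]
  constructor <;> rintro ⟨h3, h4⟩ <;> constructor <;> linarith

lemma exists_nat_of_subset_unit (hn : 1 ≤ n) {Q : DyadicCube n}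
    (h : Q.toSet ⊆ (unit n).toSet) : ∃ K : ℕ, Q.k = -K := by
  have := side_le_of_subset hn h
  simp only [side, unit, zpow_zero] at this
  have : Q.k ≤ 0 := by
    by_contra hk
    exact absurd this (not_le.2 (one_lt_zpow₀ (by norm_num) (by omega)))
  exact ⟨Q.k.natAbs, by omega⟩

lemma eq_unit_or_parent_subset (hn : 1 ≤ n) {Q : DyadicCube n} (h : Q.toSet ⊆ (unit n).toSet) :
    Q = unit n ∨ (Q.side ≤ 1 / 2 ∧ Q.parent.toSet ⊆ (unit n).toSet) := by
  obtain ⟨K, hK⟩ := exists_nat_of_subset_unit hn h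
  have hj := (subset_unit_iff hK).1 h
  rcases K with _ | K
  · left
    ext i
    · simpa [unit] using hK
    · have := hj i
      simp only [unit]
      rw [pow_zero] at this
      omega
  · right
    constructor
    · have h1 := Q.side_eq_zpow_neg hK
      have h2 : (1 : ℝ) ≤ 2 ^ K := one_le_pow₀ (by norm_num)
      rw [pow_succ] at h1
      nlinarith [Q.side_pos]
    · have hKp : Q.parent.k = -K := by
        simp only [parent]; push_cast at hK; omega
      refine (subset_unit_iff hKp).2 fun i => ?_
      have := hj i
      rw [pow_succ] at this
      simp only [parent]
      omega

/-- The dyadic cube of sidelength `2 ^ (-K)` that contains `y`. -/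
noncomputable def around (y : Fin n → ℝ) (K : ℕ) : DyadicCube n := ⟨-K, fun i => ⌈y i * 2 ^ K⌉ - 1⟩

lemma mem_iff_ceil {Q : DyadicCube n} {K : ℕ} (hK : Q.k = -K) {y : Fin n → ℝ} :
    y ∈ Q.toSet ↔ ∀ i, ⌈y i * 2 ^ K⌉ = Q.j i + 1 := by
  refine forall_congr' fun i => ?_
  have hp : (0 : ℝ) < 2 ^ K := by positivity
  rw [hK, zpow_neg, zpow_natCast, Int.ceil_eq_iff, ← div_eq_mul_inv, ← div_eq_mul_inv,
    div_lt_iff₀ hp, le_div_iff₀ hp]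
  push_cast
  rw [add_sub_cancel_right]

lemma mem_around (y : Fin n → ℝ) (K : ℕ) : y ∈ (around y K).toSet :=
  (mem_iff_ceil (Q := around y K) rfl).2 fun i => by simp [around]

lemma eq_around {Q : DyadicCube n} {K : ℕ} (hK : Q.k = -K) {y : Fin n → ℝ} (hy : y ∈ Q.toSet) :
    Q = around y K := by
  ext i
  · exact hK
  · have := (mem_iff_ceil hK).1 hy i
    simp only [around]
    omega

lemma around_subset_unit {y : Fin n → ℝ} (hy : y ∈ (unit n).toSet) (K : ℕ) :
    (around y K).toSet ⊆ (unit n).toSet := by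
  refine (subset_unit_iff (K := K) rfl).2 fun i => ?_
  have hp : (0 : ℝ) < 2 ^ K := by positivity
  have h := hy i
  simp only [unit, zpow_zero, Int.cast_zero, zero_add, mul_one] at h
  have h1 : 0 < ⌈y i * 2 ^ K⌉ := Int.ceil_pos.2 (mul_pos h.1 hp)
  have h2 : ⌈y i * 2 ^ K⌉ ≤ 2 ^ K := by
    rw [Int.ceil_le]
    push_cast
    nlinarith [h.2]
  simp only [around]
  omega

lemma around_side (y : Fin n → ℝ) (K : ℕ) : (around y K).side = (1 / 2) ^ K := by
  rw [side, around, zpow_neg, zpow_natCast, one_div, inv_pow]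

end DyadicCube

/-! ### The Calderón–Zygmund decomposition -/

lemma IsOK.mono {m : ℕ} {p : ℝ} (hp : (n : ℝ) < p) {𝒜 : Finset (Fin n → ℕ)} {ε₀ : ℝ}
    (hε₀ : 0 < ε₀) {E : Finset (Fin n → ℝ)} {Q Q' : DyadicCube n}
    (hsub : Q.dilate 3 ⊆ Q'.dilate 3) (hs : Q.side ≤ Q'.side) (h : IsOK m p 𝒜 ε₀ E Q') :
    IsOK m p 𝒜 ε₀ E Q := by
  have hsub' := Set.inter_subset_inter_right (E : Set (Fin n → ℝ)) hsub
  rcases h with h | ⟨𝒜', h1, h2, h3⟩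
  · exact Or.inl ((Set.ncard_le_ncard hsub' (E.finite_toSet.inter_of_left _)).trans h)
  · exact Or.inr ⟨𝒜', h1, h2, fun x hx => (h3 x (hsub' hx)).mono hp h1 hε₀
      (by linarith [Q.side_pos]) (by linarith) hsub'⟩

/-- All of `E` lies in `3Q°`, so an OK unit cube would provide bases at scale `30`, hence at scale
`1`, against the assumption on the labels below `𝒜`. -/
lemma not_isOK_unit {m : ℕ} {p : ℝ} (hp : (n : ℝ) < p) {𝒜 : Finset (Fin n → ℕ)} {ε₀ : ℝ}
    (hε₀ : 0 < ε₀) {E : Finset (Fin n → ℝ)} (hE : 2 ≤ E.card)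
    (hsub : (E : Set (Fin n → ℝ)) ⊆ (DyadicCube.unit n).dilate (1 / 8))
    (hmin : ∀ 𝒜' : Finset (Fin n → ℕ), 𝒜' ⊆ multiIndices n m → LabelLT 𝒜' 𝒜 →
      ∃ x ∈ E, ¬ ContainsBasis m p 𝒜' x ε₀ 1 (sigma m p x (E : Set (Fin n → ℝ)))) :
    ¬ IsOK m p 𝒜 ε₀ E (DyadicCube.unit n) := by
  have hus := DyadicCube.unit_side n
  have hE3 : (E : Set (Fin n → ℝ)) ∩ (DyadicCube.unit n).dilate 3 = E := by
    refine Set.inter_eq_left.2 fun x hx i => ?_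
    have := hsub hx i
    rw [hus] at this ⊢
    constructor <;> linarith [this.1, this.2]
  rintro (h | ⟨𝒜', h1, h2, h3⟩)
  · rw [hE3, Set.ncard_coe_finset] at h
    omega
  · rw [hE3] at h3
    obtain ⟨x, hx, hx'⟩ := hmin 𝒜' h1 h2
    exact hx' ((h3 x hx).mono hp h1 hε₀ one_pos (by rw [hus]; norm_num) subset_rfl)

lemma exists_separation {X : Type*} [MetricSpace X] (E : Finset X) :
    ∃ η > 0, ∀ x ∈ E, ∀ y ∈ E, x ≠ y → η ≤ dist x y := by
  classical
  rcases E.offDiag.eq_empty_or_nonempty with h | h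
  · refine ⟨1, one_pos, fun x hx y hy hxy => ?_⟩
    have : (x, y) ∈ E.offDiag := Finset.mem_offDiag.2 ⟨hx, hy, hxy⟩
    simp [h] at this
  · obtain ⟨q, hq, hmin⟩ := E.offDiag.exists_min_image (fun q => dist q.1 q.2) h
    exact ⟨dist q.1 q.2, dist_pos.2 (Finset.mem_offDiag.1 hq).2.2, fun x hx y hy hxy =>
      hmin (x, y) (Finset.mem_offDiag.2 ⟨hx, hy, hxy⟩)⟩

/-- Everything but the covering and the location of `E` rests on the parent not being OK: its triple
contains two points of `E`, which gives nearness and, by separation, a lower bound for the sides,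
hence finiteness. -/
lemma isWhitney_CZ (hn : 1 ≤ n) {m : ℕ} {p : ℝ} (hp : (n : ℝ) < p) {𝒜 : Finset (Fin n → ℕ)}
    {ε₀ : ℝ} (hε₀ : 0 < ε₀) {E : Finset (Fin n → ℝ)}
    (hsub : (E : Set (Fin n → ℝ)) ⊆ (DyadicCube.unit n).dilate (1 / 8))
    (hunit : ¬ IsOK m p 𝒜 ε₀ E (DyadicCube.unit n)) : IsWhitney (CZ m p 𝒜 ε₀ E) E := by
  obtain ⟨η, hη, hsep⟩ := exists_separation E
  have hpar : ∀ Q ∈ CZ m p 𝒜 ε₀ E, Q.side ≤ 1 / 2 ∧ ¬ IsOK m p 𝒜 ε₀ E Q.parent := by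
    rintro Q ⟨h1, h2, h3⟩
    rcases DyadicCube.eq_unit_or_parent_subset hn h1 with rfl | ⟨h4, h5⟩
    · exact absurd h2 hunit
    · exact ⟨h4, h3 _ h5 (Q.toSet_ssubset_parent hn)⟩
  have hpair : ∀ Q ∈ CZ m p 𝒜 ε₀ E, ∃ x ∈ E, ∃ y ∈ E, x ≠ y ∧
      ‖x - Q.parent.center‖ ≤ 3 * Q.side ∧ ‖y - Q.parent.center‖ ≤ 3 * Q.side := by
    intro Q hQ
    have h := (hpar Q hQ).2
    simp only [IsOK, not_or, not_le] at h
    obtain ⟨x, hx, y, hy, hxy⟩ :=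
      (Set.one_lt_ncard (E.finite_toSet.inter_of_left _)).1 h.1
    have hb : ∀ z ∈ Q.parent.dilate 3, ‖z - Q.parent.center‖ ≤ 3 * Q.side := fun z hz => by
      have := DyadicCube.norm_sub_center_le_of_mem_dilate (by norm_num) hz
      rw [Q.parent_side] at this
      linarith
    exact ⟨x, hx.1, y, hy.1, hxy, hb x hx.2, hb y hy.2⟩
  refine ⟨?_, ?_, fun Q hQ => hQ.1, ?_, ?_, fun Q hQ => (hpar Q hQ).1, ?_⟩
  · obtain ⟨D, hD⟩ := DyadicCube.exists_packing n (6 / η)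
    have hKa : 6 / η * (η / 6) = 1 := by field_simp
    refine (hD _ (η / 6) (DyadicCube.unit n).center (by positivity) fun Q hQ => ⟨?_, ?_, ?_⟩).1
    · obtain ⟨x, hx, y, hy, hxy, h1, h2⟩ := hpair Q hQ
      have h3 := hsep x hx y hy hxy
      rw [dist_eq_norm] at h3
      have : ‖x - y‖ ≤ 6 * Q.side :=
        calc ‖x - y‖ = ‖(x - Q.parent.center) - (y - Q.parent.center)‖ := by congr 1; abel
          _ ≤ _ := norm_sub_le _ _
          _ ≤ _ := by linarith
      linarith
    · rw [hKa]; linarith [(hpar Q hQ).1]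
    · rw [hKa]
      have := DyadicCube.norm_sub_center_le_of_mem (hQ.1 Q.center_mem)
      rw [DyadicCube.unit_side] at this
      linarith
  · intro y hy
    classical
    have hex : ∃ K : ℕ, IsOK m p 𝒜 ε₀ E (DyadicCube.around y K) := by
      obtain ⟨K, hK⟩ := exists_pow_lt_of_lt_one (show 0 < η / 3 by positivity)
        (show (1 / 2 : ℝ) < 1 by norm_num)
      refine ⟨K, Or.inl ?_⟩
      rw [← DyadicCube.around_side y K] at hK
      rw [Set.ncard_le_one (E.finite_toSet.inter_of_left _)]
      rintro a ⟨ha, ha'⟩ b ⟨hb, hb'⟩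
      by_contra hab
      have h1 := DyadicCube.norm_sub_center_le_of_mem_dilate (by norm_num) ha'
      have h2 := DyadicCube.norm_sub_center_le_of_mem_dilate (by norm_num) hb'
      have h3 := hsep a ha b hb hab
      rw [dist_eq_norm] at h3
      have : ‖a - b‖ ≤ 3 * (DyadicCube.around y K).side :=
        calc ‖a - b‖ = ‖(a - (DyadicCube.around y K).center) -
              (b - (DyadicCube.around y K).center)‖ := by congr 1; abel
          _ ≤ _ := norm_sub_le _ _
          _ ≤ _ := by linarith
      linarith
    -- The least exponent gives the largest OK cube containing `y`; any larger dyadic cube around it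
    -- also contains `y` and would have a smaller exponent.
    refine ⟨DyadicCube.around y (Nat.find hex), ⟨DyadicCube.around_subset_unit hy _,
      Nat.find_spec hex, fun Q' hQ' hss hOK => ?_⟩, DyadicCube.mem_around y _⟩
    obtain ⟨K, hK⟩ := DyadicCube.exists_nat_of_subset_unit hn hQ'
    obtain rfl := DyadicCube.eq_around hK (hss.1 (DyadicCube.mem_around y _))
    have hle := Nat.find_min' hex hOK
    have hside := DyadicCube.side_le_of_subset hn hss.1
    rw [DyadicCube.around_side, DyadicCube.around_side] at hside
    have := (pow_le_pow_iff_right_of_lt_one₀ (by norm_num : (0 : ℝ) < 1 / 2)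
      (by norm_num)).1 hside
    obtain rfl : K = Nat.find hex := le_antisymm this hle
    exact hss.2 subset_rfl
  · intro Q hQ Q' hQ'
    by_contra hlt
    rw [not_lt] at hlt
    have h1 := Q.norm_parent_center_sub_le
    have hs := Q.side_pos
    have h2 : ‖Q.parent.center - Q'.center‖ ≤ Q.side / 2 + ‖Q.center - Q'.center‖ :=
      calc ‖Q.parent.center - Q'.center‖
          = ‖(Q.parent.center - Q.center) + (Q.center - Q'.center)‖ := by congr 1; abel
        _ ≤ _ := norm_add_le _ _
        _ ≤ _ := by linarith
    -- If `Q'` were too large, its triple would contain that of the parent of `Q`, and the parent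
    -- would be OK.
    refine (hpar Q hQ).2 (IsOK.mono hp hε₀ (DyadicCube.dilate_three_subset ?_) ?_ hQ'.2.1)
    · rw [Q.parent_side]; linarith
    · rw [Q.parent_side]; linarith [norm_nonneg (Q.center - Q'.center)]
  · intro Q hQ
    obtain ⟨x, hx, -, -, -, h1, -⟩ := hpair Q hQ
    refine ⟨x, hx, ?_⟩
    have h2 := Q.norm_parent_center_sub_le
    calc ‖x - Q.center‖ = ‖(x - Q.parent.center) + (Q.parent.center - Q.center)‖ := by
          congr 1; abel
      _ ≤ _ := norm_add_le _ _
      _ ≤ _ := by linarith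
  · intro x hx
    have := DyadicCube.norm_sub_center_le_of_mem_dilate (by norm_num) (hsub hx)
    rw [DyadicCube.unit_side] at this
    linarith

end SobolevExt

theorem mainTheorem6 (m n : ℕ) (hm : 1 ≤ m) (hn : 1 ≤ n) (p : ℝ) (hp : (n : ℝ) < p) :
    ∃ C c : ℝ, 0 < C ∧ 0 < c ∧ c < 1 ∧
      ∀ (𝒜 : Finset (Fin n → ℕ)), 𝒜 ⊂ multiIndices n m →
      ∀ (ε₀ : ℝ), 0 < ε₀ →
      ∀ (E : Finset (Fin n → ℝ)), 2 ≤ E.card →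
      (E : Set (Fin n → ℝ)) ⊆ (DyadicCube.unit n).dilate (1 / 8) →
      (∀ 𝒜' : Finset (Fin n → ℕ), 𝒜' ⊆ multiIndices n m → LabelLT 𝒜' 𝒜 →
        ∃ x ∈ E, ¬ ContainsBasis m p 𝒜' x ε₀ 1 (sigma m p x (E : Set (Fin n → ℝ)))) →
      (CZ m p 𝒜 ε₀ E).Finite ∧
      ∃ (L : CZ m p 𝒜 ε₀ E → ℕ) (S : CZ m p 𝒜 ε₀ E → ℕ → CZ m p 𝒜 ε₀ E),
        -- (K1), for the sequence `S Q 1, …, S Q (L Q)`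
        (∀ Q : CZ m p 𝒜 ε₀ E,
          1 ≤ L Q ∧ S Q 1 = Q ∧ (S Q (L Q)).1 ∈ keystone (CZ m p 𝒜 ε₀ E) ∧
          (∀ l, 1 ≤ l → l < L Q → (S Q l).1.Neighbor (S Q (l + 1)).1) ∧
          (∀ l k, 1 ≤ l → l ≤ k → k ≤ L Q →
            (S Q k).1.side ≤ C * (1 - c) ^ (k - l) * (S Q l).1.side)) ∧
        -- (K2)
        (({q : CZ m p 𝒜 ε₀ E × CZ m p 𝒜 ε₀ E |
            q.1.1.Neighbor q.2.1 ∧ S q.1 (L q.1) ≠ S q.2 (L q.2)}.ncard : ℝ) ≤ C * (E.card : ℝ)) ∧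
        -- (K3)
        (∀ Q : CZ m p 𝒜 ε₀ E, Q.1 ∈ keystone (CZ m p 𝒜 ε₀ E) → S Q (L Q) = Q) := by
  obtain ⟨C, c, hC, hc, hc1, H⟩ := exists_keystone_sequences n
  refine ⟨C, c, hC, hc, hc1, fun 𝒜 _ ε₀ hε₀ E hE hsub hmin => ?_⟩
  have hW := isWhitney_CZ hn hp hε₀ hsub (not_isOK_unit hp hε₀ hE hsub hmin)
  exact ⟨hW.finite, H _ E hW⟩
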